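/- Call a countably infinite ultrahomogeneous first-order structure $M$ a \emph{Fraïssé structure}. The $\omega$-age of $M$ is the class of all structures (finite or infinite) that embed in $M$. Say that $\mathrm{Aut}(M)$ is \emph{universal} if for each $A$ in the $\omega$-age of $M$ there is a group embedding $\mathrm{Aut}(A) \to \mathrm{Aut}(M)$. An embedding $f : A \to M$ is \emph{group-extensive} if there is a group embedding $\eta : \mathrm{Aut}(f(A)) \to \mathrm{Aut}(M)$ such that $\eta(g)$ extends $g$ for every $g \in \mathrm{Aut}(f(A))$; the $\omega$-age of $M$ is \emph{group-extensible} if each of its members $A$ admits a group-extensive embedding $A \to M$. The structure $M$ is \emph{transitive} if $\mathrm{Aut}(M)$ acts transitively on $M$, and has \emph{strong amalgamation} if each pair of embeddings $B \leftarrow A \rightarrow C$ in the age of $M$ (the class of finitely generated structures embeddable in $M$) has an amalgam $B \to D \leftarrow C$ in the age of $M$ in which the images of $B$ and $C$ intersect exactly in the image of $A$. Let $L = \{R, S\}$ be the relational language with $R$ binary and $S$ $4$-ary. Let $\mathcal{D}$ be the class of finite $L$-structures $A$ such that: (1) $R^A$ is irreflexive and asymmetric, and each set of three vertices of $A$ contains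 at least one oriented edge (that is, $(A, R^A)$ is an $I_3$-free oriented graph); (2) each tuple in $S^A$ has all its entries in some $4$-element subset of $A$, and each $4$-element subset $B$ of $A$ has an enumeration $b_0, b_1, b_2, b_3$ such that $S^A \cap B^4 = \{(b_0, b_1, b_2, b_3), (b_2, b_3, b_0, b_1)\}$ (that is, $(A, S^A)$ is a semifinal structure). \textbf{Theorem.} The class $\mathcal{D}$ has a Fraïssé limit $\mathbb{D}$: a countable ultrahomogeneous $L$-structure whose age is $\mathcal{D}$. This $\mathbb{D}$ is a Fraïssé structure in a finite relational language, it is transitive and has strong amalgamation, $\mathrm{Aut}(\mathbb{D})$ is universal, and the $\omega$-age of $\mathbb{D}$ is not group-extensible. Consequently, it is not true that every Fraïssé structure with universal automorphism group has group-extensible $\omega$-age. -/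

import Mathlib

open FirstOrder

universe u v w

namespace SemifinalStructure

section General

variable (L : FirstOrder.Language.{u, v}) (M : Type w) [L.Structure M]

/-- The automorphism group of a first-order structure, under composition. -/
instance autGroup : Group (M ≃[L] M) where
  mul f g := f.comp g
  one := FirstOrder.Language.Equiv.refl L M
  inv f := f.symm
  mul_assoc _ _ _ := rfl
  one_mul _ := rfl
  mul_one _ := rfl
  inv_mul_cancel f := FirstOrder.Language.Equiv.symm_comp_self f

/-- A Fraïssé structure: a countably infinite ultrahomogeneous structure. -/
structure IsFraisseStructure : Prop where
  countable : Countable M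
  infinite : Infinite M
  ultrahomogeneous : L.IsUltrahomogeneous M

/-- The automorphism group acts transitively on the domain. -/
def IsTransitive : Prop :=
  ∀ x y : M, ∃ g : M ≃[L] M, g x = y

/-- Strong amalgamation of the age of `M`: every pair of embeddings `B ← A → C` in the age has an
amalgam `B → D ← C` in the age in which the images of `B` and `C` meet exactly in the image
of `A`. -/
def HasStrongAmalgamation : Prop :=
  ∀ A B C : CategoryTheory.Bundled.{w} L.Structure,
    A ∈ L.age M → B ∈ L.age M → C ∈ L.age M →
    ∀ (f : A ↪[L] B) (g : A ↪[L] C),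
      ∃ D ∈ L.age M, ∃ (f' : B ↪[L] D) (g' : C ↪[L] D),
        f'.comp f = g'.comp g ∧
        Set.range f' ∩ Set.range g' = Set.range (f'.comp f)

/-- The `ω`-age of `M`: the class of all structures (finite or infinite) embeddable in `M`. -/
def omegaAge : Set (CategoryTheory.Bundled.{w} L.Structure) :=
  {A | Nonempty (A ↪[L] M)}

/-- `Aut(M)` is universal: `Aut(A)` embeds as a group in `Aut(M)` for each `A` in the `ω`-age. -/
def HasUniversalAut : Prop :=
  ∀ A ∈ omegaAge L M, ∃ φ : (A ≃[L] A) →* (M ≃[L] M), Function.Injective φ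

variable {L M} in
/-- An embedding `f : A → M` is group-extensive if there is a group embedding
`η : Aut(f(A)) → Aut(M)` such that `η g` extends `g` for every `g`. -/
def IsGroupExtensive {A : Type*} [L.Structure A] (f : A ↪[L] M) : Prop :=
  ∃ η : (f.toHom.range ≃[L] f.toHom.range) →* (M ≃[L] M),
    Function.Injective η ∧
    ∀ (g : f.toHom.range ≃[L] f.toHom.range) (x : f.toHom.range), η g (x : M) = (g x : M)

/-- The `ω`-age of `M` is group-extensible: each of its members has a group-extensive embedding
in `M`. -/
def IsGroupExtensible : Prop :=
  ∀ A ∈ omegaAge L M, ∃ f : A ↪[L] M, IsGroupExtensive f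

end General

/-- The relation symbols: a binary symbol `R` and a `4`-ary symbol `S`. -/
inductive Rel : ℕ → Type
  | R : Rel 2
  | S : Rel 4

/-- The relational language `{R, S}`. -/
def lang : FirstOrder.Language.{0, 0} := ⟨fun _ => Empty, Rel⟩

instance : lang.IsRelational := fun _ => inferInstanceAs (IsEmpty Empty)

section Class

variable {A : Type w} [lang.Structure A]

/-- There is an oriented edge from `x` to `y`. -/
def edge (x y : A) : Prop :=
  FirstOrder.Language.Structure.RelMap (L := lang) Rel.R ![x, y]

/-- The `4`-ary relation `S` of a structure. -/
def semi (x : Fin 4 → A) : Prop :=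
  FirstOrder.Language.Structure.RelMap (L := lang) Rel.S x

variable (A)

/-- The `R`-reduct is an `I₃`-free oriented graph: `R` is irreflexive and asymmetric, and every
set of three vertices contains at least one oriented edge. -/
structure IsI3FreeOrientedGraph : Prop where
  irrefl : ∀ x : A, ¬ edge x x
  asymm : ∀ x y : A, edge x y → ¬ edge y x
  i3_free : ∀ B : Finset A, B.card = 3 → ∃ x ∈ B, ∃ y ∈ B, edge x y

/-- The `S`-reduct is a semifinal structure: each tuple in `S` lies in a `4`-set, and each `4`-set
`B` has an enumeration `b₀, b₁, b₂, b₃` such that the restriction of `S` to `B` consists exactly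
of `(b₀, b₁, b₂, b₃)` and `(b₂, b₃, b₀, b₁)`. -/
structure IsSemifinalStructure : Prop where
  support : ∀ x : Fin 4 → A, semi x → ∃ B : Finset A, B.card = 4 ∧ ∀ i, x i ∈ B
  semifinal : ∀ B : Finset A, B.card = 4 →
    ∃ b : Fin 4 → A, Function.Injective b ∧ Set.range b = (B : Set A) ∧
      ∀ x : Fin 4 → A, (∀ i, x i ∈ B) →
        (semi x ↔ x = ![b 0, b 1, b 2, b 3] ∨ x = ![b 2, b 3, b 0, b 1])

end Class

/-- The class of finite `I₃`-free oriented graphs equipped with a semifinal relation. -/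
def classD : Set (CategoryTheory.Bundled.{0} lang.Structure) :=
  {A | Finite A ∧ IsI3FreeOrientedGraph A ∧ IsSemifinalStructure A}

end SemifinalStructure

/-!
The Fraïssé limit of `classD` is built together with group actions on it. A countable structure is
*rich* (`IsRich`) if every type of the class over a finite set is realized, outside any given
finite set. A rich structure of the class is a Fraïssé limit, is transitive, and has strong
amalgamation, all by `IsRich.exists_embedding`; so any two countable ones are isomorphic.

The main construction is equivariant. Let a group `G` act by automorphisms on a structure `X` of
the class. The relation `S` forces `G` to act on each `4`-set that it preserves as the identity or
as one pair of disjoint transpositions, whence no element has a `4`-cycle, a `3`-cycle and a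
fixed point, or a `2`-cycle and two fixed points (`TameAction`). Two points interchanged by `G` are
not adjacent. A new point `p`, realizing a type over a finite set, is attached to a
finite tuple of old points, its anchor, whose pointwise stabilizer is the stabilizer of `p`. The
orbits of new points then inherit tameness, so that `S` can be chosen invariantly on new `4`-sets,
and edges between new points can be chosen invariantly, leaving non-adjacent only the pairs
interchanged by `G`. What could go wrong is the absence of independent triples: if `g` interchanges
`p` and `g • p` and fixes an old point `x` not adjacent to `p`, then `x`, `p`, `g • p` are
independent. This is excluded by taking an anchor that is good for `x` (`IsGood`): no `g` that
fixes `x` is a nontrivial involution on the anchor. If all points have good tuples, the extension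
exists and again has good tuples (`exists_extension`, `hasGoodTuples_ext`), and the limit of the
iterated extensions is a rich structure with an action of `G` (`exists_rich_extension`).

For the trivial group this gives the Fraïssé limit. For universality, `G` is the automorphism group
of a countable structure `A` of the class. A point without good tuples is adjacent to all other
points of `A`, and there is at most one such point, as some automorphism moves any given other
point to a point not adjacent to it. It is therefore fixed by `G` and can be removed from `A`; in
what is left, all tuples are good (`exists_stage_of_not_hasGoodTuples`).

This removal is what group-extensibility does not allow. In the structure on three points with
edges `0 → 1` and `0 → 2`, the automorphism that interchanges `1` and `2` fixes `0`. An extension of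
it to an involution of the Fraïssé limit would move every other point, in particular a point `y` not
adjacent to `0`, and then `0`, `y` and the image of `y` would be independent
(`IsRich.not_isGroupExtensible`).
-/

namespace SemifinalStructure

/-! ### The class in terms of tuples -/

section Tuples

variable {A B : Type*} [lang.Structure A] [lang.Structure B]

/-- The vertices `x` and `y` are joined by an edge, in one direction or the other. -/
def adj (x y : A) : Prop := edge x y ∨ edge y x

theorem adj_comm {x y : A} : adj x y ↔ adj y x := or_comm

/-- The permutation `(0 2)(1 3)`; its powers are the automorphisms of a semifinal `4`-set. -/
def rot : Equiv.Perm (Fin 4) := Equiv.addRight 2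

theorem rot_mul_rot : rot * rot = 1 := by decide

/-- The axioms of `classD`, in a form that makes sense for structures of any cardinality, with
sets of vertices replaced by injective tuples. -/
structure IsLocallyD (A : Type*) [lang.Structure A] : Prop where
  asymm : ∀ x y : A, edge x y → ¬ edge y x
  i3_free : ∀ x y z : A, x ≠ y → x ≠ z → y ≠ z → adj x y ∨ adj x z ∨ adj y z
  injective : ∀ x : Fin 4 → A, semi x → Function.Injective x
  semifinal : ∀ x : Fin 4 → A, Function.Injective x →
    ∃ π : Equiv.Perm (Fin 4), ∀ σ : Equiv.Perm (Fin 4),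
      semi (x ∘ σ) ↔ σ = π ∨ σ = π * rot

theorem IsLocallyD.irrefl (h : IsLocallyD A) (x : A) : ¬ edge x x :=
  fun hx => h.asymm x x hx hx

theorem vec_eq_comp_rot {A : Type*} (b : Fin 4 → A) : ![b 2, b 3, b 0, b 1] = b ∘ rot := by
  funext i; fin_cases i <;> rfl

theorem vec_eq_self {A : Type*} (b : Fin 4 → A) : ![b 0, b 1, b 2, b 3] = b := by
  funext i; fin_cases i <;> rfl

theorem exists_perm_of_range_eq {A : Type*} {x y : Fin 4 → A} (hx : Function.Injective x)
    (hy : Function.Injective y) (h : Set.range x = Set.range y) :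
    ∃ σ : Equiv.Perm (Fin 4), y = x ∘ σ := by
  refine ⟨(Equiv.ofInjective y hy).trans
    ((Equiv.setCongr h.symm).trans (Equiv.ofInjective x hx).symm), ?_⟩
  funext i
  simp [Equiv.apply_ofInjective_symm]

theorem isLocallyD_iff :
    IsLocallyD A ↔ IsI3FreeOrientedGraph A ∧ IsSemifinalStructure A := by
  classical
  constructor
  · intro h
    refine ⟨⟨h.irrefl, h.asymm, ?_⟩, ⟨?_, ?_⟩⟩
    · intro B hB
      obtain ⟨x, y, z, hxy, hxz, hyz, rfl⟩ := Finset.card_eq_three.1 hB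
      rcases h.i3_free x y z hxy hxz hyz with (h | h) | (h | h) | (h | h)
      · exact ⟨x, by simp, y, by simp, h⟩
      · exact ⟨y, by simp, x, by simp, h⟩
      · exact ⟨x, by simp, z, by simp, h⟩
      · exact ⟨z, by simp, x, by simp, h⟩
      · exact ⟨y, by simp, z, by simp, h⟩
      · exact ⟨z, by simp, y, by simp, h⟩
    · intro x hx
      refine ⟨Finset.univ.image x, ?_, by simp⟩
      rw [Finset.card_image_of_injective _ (h.injective x hx)]
      simp
    · intro B hB
      let e : Fin 4 ≃ B := (B.equivFinOfCardEq hB).symm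
      have hx : Function.Injective fun i => (e i : A) :=
        Subtype.val_injective.comp e.injective
      have hr : Set.range (fun i => (e i : A)) = B := by
        ext a
        constructor
        · rintro ⟨i, rfl⟩
          exact (e i).2
        · intro ha
          exact ⟨e.symm ⟨a, ha⟩, by simp⟩
      obtain ⟨π, hπ⟩ := h.semifinal _ hx
      refine ⟨(fun i => (e i : A)) ∘ π, hx.comp π.injective, ?_, ?_⟩
      · rw [π.surjective.range_comp, hr]
      · intro x hxB
        rw [vec_eq_comp_rot, vec_eq_self]
        constructor
        · intro hs
          have hxi := h.injective x hs
          have : ∃ σ : Equiv.Perm (Fin 4), x = (fun i => (e i : A)) ∘ σ := by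
            apply exists_perm_of_range_eq hx hxi
            rw [hr]
            symm
            have h1 : Finset.univ.image x = B := by
              apply Finset.eq_of_subset_of_card_le
              · intro a ha
                obtain ⟨i, -, rfl⟩ := Finset.mem_image.1 ha
                exact hxB i
              · rw [Finset.card_image_of_injective _ hxi, hB]
                simp
            rw [← h1]
            simp
          obtain ⟨σ, rfl⟩ := this
          rcases (hπ σ).1 hs with rfl | rfl
          · exact Or.inl rfl
          · exact Or.inr rfl
        · rintro (rfl | rfl)
          · exact (hπ π).2 (Or.inl rfl)
          · exact (hπ (π * rot)).2 (Or.inr rfl)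
  · rintro ⟨hG, hS⟩
    have hinj : ∀ x : Fin 4 → A, semi x → Function.Injective x := by
      intro x hx
      obtain ⟨B, hB, hxB⟩ := hS.support x hx
      obtain ⟨b, hb, -, hs⟩ := hS.semifinal B hB
      rw [vec_eq_comp_rot, vec_eq_self] at hs
      rcases (hs x hxB).1 hx with rfl | rfl
      · exact hb
      · exact hb.comp rot.injective
    refine ⟨hG.asymm, ?_, hinj, ?_⟩
    · intro x y z hxy hxz hyz
      obtain ⟨a, ha, b, hb, hab⟩ :=
        hG.i3_free {x, y, z} (Finset.card_eq_three.2 ⟨x, y, z, hxy, hxz, hyz, rfl⟩)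
      have hne : a ≠ b := by
        rintro rfl
        exact hG.irrefl a hab
      simp only [Finset.mem_insert, Finset.mem_singleton] at ha hb
      unfold adj
      rcases ha with rfl | rfl | rfl <;> rcases hb with rfl | rfl | rfl <;> tauto
    · intro x hx
      obtain ⟨b, hb, hr, hs⟩ := hS.semifinal (Finset.univ.image x)
        (by rw [Finset.card_image_of_injective _ hx]; simp)
      obtain ⟨π, rfl⟩ := exists_perm_of_range_eq hx hb (by rw [hr]; simp)
      refine ⟨π, fun σ => ?_⟩
      rw [hs _ (by simp), vec_eq_comp_rot, vec_eq_self]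
      constructor
      · rintro (h | h)
        · left; ext i; exact congrArg _ (hx (congrFun h i))
        · right; ext i; exact congrArg _ (hx (congrFun h i))
      · rintro (rfl | rfl)
        · exact Or.inl rfl
        · exact Or.inr rfl

theorem mem_classD_iff {A : CategoryTheory.Bundled.{0} lang.Structure} :
    A ∈ classD ↔ Finite A ∧ IsLocallyD A := by
  rw [isLocallyD_iff]; rfl

/-- The structure with given edges and given `4`-ary relation. -/
@[reducible]
def mkStructure {A : Type*} (E : A → A → Prop) (S : (Fin 4 → A) → Prop) :
    lang.Structure A where
  funMap f _ := Empty.elim f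
  RelMap {_} r := match r with
    | Rel.R => fun x => E (x 0) (x 1)
    | Rel.S => fun x => S x

/-- An injective map preserving and reflecting both relations is an embedding. -/
def mkEmbedding (f : A → B) (hf : Function.Injective f)
    (he : ∀ x y, edge (f x) (f y) ↔ edge x y) (hs : ∀ x : Fin 4 → A, semi (f ∘ x) ↔ semi x) :
    A ↪[lang] B where
  toFun := f
  inj' := hf
  map_fun' g _ := Empty.elim g
  map_rel' {n} r x := by
    change Rel n at r
    cases r with
    | R =>
      have h := he (x 0) (x 1)
      have h1 : ![x 0, x 1] = x := by funext i; fin_cases i <;> rfl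
      have h2 : ![f (x 0), f (x 1)] = f ∘ x := by funext i; fin_cases i <;> rfl
      unfold edge at h
      rw [h1, h2] at h
      exact h
    | S => exact hs x

@[simp]
theorem mkEmbedding_apply (f : A → B) (hf he hs) (x : A) : mkEmbedding f hf he hs x = f x := rfl

theorem edge_map (f : A ↪[lang] B) (x y : A) : edge (f x) (f y) ↔ edge x y := by
  have h := f.map_rel Rel.R ![x, y]
  have h2 : f ∘ ![x, y] = ![f x, f y] := by funext i; fin_cases i <;> rfl
  rw [h2] at h
  exact h

theorem semi_map (f : A ↪[lang] B) (x : Fin 4 → A) : semi (f ∘ x) ↔ semi x :=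
  f.map_rel Rel.S x

theorem adj_map (f : A ↪[lang] B) (x y : A) : adj (f x) (f y) ↔ adj x y := by
  simp only [adj, edge_map]

/-- A bijection preserving and reflecting both relations is an isomorphism. -/
def mkEquiv (f : A ≃ B)
    (he : ∀ x y, edge (f x) (f y) ↔ edge x y) (hs : ∀ x : Fin 4 → A, semi (f ∘ x) ↔ semi x) :
    A ≃[lang] B where
  toEquiv := f
  map_fun' g _ := Empty.elim g
  map_rel' r x := (mkEmbedding f f.injective he hs).map_rel r x

theorem IsLocallyD.of_embedding (h : IsLocallyD B) (f : A ↪[lang] B) : IsLocallyD A where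
  asymm x y := by
    rw [← edge_map f, ← edge_map f y]
    exact h.asymm _ _
  i3_free x y z hxy hxz hyz := by
    simp only [← adj_map f]
    exact h.i3_free _ _ _ (f.injective.ne hxy) (f.injective.ne hxz) (f.injective.ne hyz)
  injective x hx := ((h.injective _ ((semi_map f x).2 hx))).of_comp
  semifinal x hx := by
    obtain ⟨π, hπ⟩ := h.semifinal (f ∘ x) (f.injective.comp hx)
    exact ⟨π, fun σ => by rw [← hπ σ, ← semi_map f]; rfl⟩

end Tuples

/-! ### Groups acting on structures of the class -/

/-- The group `G` acts on `X` by automorphisms. -/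
class ActsByAut (G X : Type*) [Group G] [MulAction G X] [lang.Structure X] : Prop where
  edge_smul : ∀ (g : G) (x y : X), edge (g • x) (g • y) ↔ edge x y
  semi_smul : ∀ (g : G) (x : Fin 4 → X), semi (g • x) ↔ semi x

section Actions

variable {G X : Type*} [Group G] [MulAction G X] [lang.Structure X]

theorem adj_smul [h : ActsByAut G X] (g : G) (x y : X) :
    adj (g • x) (g • y) ↔ adj x y := by
  simp only [adj, h.edge_smul]

theorem not_adj_of_swap (hX : IsLocallyD X) [h : ActsByAut G X] {g : G} {x y : X}
    (h1 : g • x = y) (h2 : g • y = x) : ¬ adj x y := by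
  have key : edge x y ↔ edge y x := by
    rw [← h.edge_smul g x y, h1, h2]
  rintro (h | h)
  · exact hX.asymm _ _ h (key.1 h)
  · exact hX.asymm _ _ h (key.2 h)

/-- An automorphism that preserves a `4`-set either fixes it pointwise or acts on it by two
disjoint transpositions, the conjugate of `rot` determined by the semifinal relation. -/
theorem perm_eq_of_smul_eq (hX : IsLocallyD X) [h : ActsByAut G X] {x : Fin 4 → X}
    (hx : Function.Injective x) :
    ∃ π : Equiv.Perm (Fin 4), ∀ (g : G) (σ : Equiv.Perm (Fin 4)), g • x = x ∘ σ →
      σ = 1 ∨ σ = π * rot * π⁻¹ := by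
  obtain ⟨π, hπ⟩ := hX.semifinal x hx
  refine ⟨π, fun g σ hg => ?_⟩
  have h1 : semi (x ∘ π) := (hπ π).2 (Or.inl rfl)
  rw [← h.semi_smul g] at h1
  have h2 : g • (x ∘ π) = x ∘ (σ * π : Equiv.Perm (Fin 4)) := by
    funext i
    exact congrFun hg (π i)
  rw [h2, hπ] at h1
  rcases h1 with h1 | h1
  · left; simpa using h1
  · right; rw [← h1]; simp

theorem conj_rot_apply_ne (π : Equiv.Perm (Fin 4)) (i : Fin 4) : (π * rot * π⁻¹) i ≠ i := by
  intro h
  have h1 : rot (π⁻¹ i) = π⁻¹ i := by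
    rw [Equiv.Perm.eq_inv_iff_eq]
    exact h
  have h2 : ∀ j, rot j ≠ j := by decide
  exact h2 _ h1

theorem conj_rot_apply_apply (π : Equiv.Perm (Fin 4)) (i : Fin 4) :
    (π * rot * π⁻¹) ((π * rot * π⁻¹) i) = i := by
  rw [← Equiv.Perm.mul_apply]
  have : π * rot * π⁻¹ * (π * rot * π⁻¹) = 1 := by
    calc _ = π * (rot * rot) * π⁻¹ := by group
      _ = 1 := by rw [rot_mul_rot]; group
  rw [this]; rfl

theorem injective_vec {X : Type*} {a b c d : X} (h1 : a ≠ b) (h2 : a ≠ c) (h3 : a ≠ d) (h4 : b ≠ c)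
    (h5 : b ≠ d) (h6 : c ≠ d) : Function.Injective ![a, b, c, d] := by
  intro i j hij
  fin_cases i <;> fin_cases j <;> simp_all

/-- The constraints on cycle lengths that the relation `S` puts on a group of automorphisms: there
are no `4`-cycles, no `3`-cycle together with a fixed point, and no `2`-cycle together with two
fixed points. -/
structure TameAction (G X : Type*) [Group G] [MulAction G X] : Prop where
  no_four : ∀ (g : G) (x : X), g • g • g • g • x = x → g • g • x = x
  no_three : ∀ (g : G) (x y : X), g • g • g • x = x → g • y = y → g • x = x
  no_two : ∀ (g : G) (x y z : X), g • g • x = x → g • y = y → g • z = z → y ≠ z → g • x = x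

theorem tameAction (hX : IsLocallyD X) [h : ActsByAut G X] : TameAction G X where
  no_four g x hg := by
    by_contra hne
    have h1 : g • x ≠ x := fun h => hne (by rw [h, h])
    have h2 : g • g • g • x ≠ x := fun h => h1 (by rw [← h, hg, h])
    have inj : Function.Injective ![x, g • x, g • g • x, g • g • g • x] := by
      apply injective_vec
      · exact h1.symm
      · exact Ne.symm hne
      · exact h2.symm
      · simpa using h1.symm
      · simpa using Ne.symm hne
      · simpa using h1.symm
    obtain ⟨π, hπ⟩ := perm_eq_of_smul_eq (G := G) hX inj
    have hσ := hπ g (finRotate 4) (by funext i; fin_cases i <;> simp [finRotate, hg] <;> rfl)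
    rcases hσ with hσ | hσ
    · exact absurd hσ (by decide)
    · have := conj_rot_apply_apply π 0
      rw [← hσ] at this
      exact absurd this (by decide)
  no_three g x y hg hy := by
    by_contra hne
    have h2 : g • g • x ≠ x := fun h => hne (by rw [h] at hg; exact hg)
    have hyx : ∀ z, z = y → g • z = z := by rintro _ rfl; exact hy
    have inj : Function.Injective ![x, g • x, g • g • x, y] := by
      apply injective_vec
      · exact Ne.symm hne
      · exact h2.symm
      · exact fun h => hne (hyx _ h)
      · simpa using Ne.symm hne
      · exact fun h => hne (by simpa using hyx _ h)
      · exact fun h => hne (by simpa using hyx _ h)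
    obtain ⟨π, hπ⟩ := perm_eq_of_smul_eq (G := G) hX inj
    have hσ := hπ g (Equiv.swap 0 2 * Equiv.swap 0 1)
      (by funext i; fin_cases i <;> simp [hg, hy, Equiv.swap_apply_def])
    rcases hσ with hσ | hσ
    · exact absurd hσ (by decide)
    · have := conj_rot_apply_ne π 3
      rw [← hσ] at this
      exact absurd this (by decide)
  no_two g x y z hg hy hz hyz := by
    by_contra hne
    have hf : ∀ w, g • w = w → x ≠ w ∧ g • x ≠ w := by
      rintro w hw
      constructor
      · rintro rfl; exact hne hw
      · rintro rfl; exact hne (by simpa using hw)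
    obtain ⟨h1, h2⟩ := hf y hy
    obtain ⟨h3, h4⟩ := hf z hz
    have inj := injective_vec (Ne.symm hne) h1 h3 h2 h4 hyz
    obtain ⟨π, hπ⟩ := perm_eq_of_smul_eq (G := G) hX inj
    have hσ := hπ g (Equiv.swap 0 1)
      (by funext i; fin_cases i <;> simp [hg, hy, hz, Equiv.swap_apply_def])
    rcases hσ with hσ | hσ
    · exact absurd hσ (by decide)
    · have := conj_rot_apply_ne π 3
      rw [← hσ] at this
      exact absurd this (by decide)

end Actions

/-! ### Invariant choices -/

section Choices

variable {G Z : Type*} [Group G] [MulAction G Z]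

/-- An invariant orientation of all pairs that are not interchanged by a group element: pairs are
compared by a well-order of the orbits of ordered pairs. -/
theorem exists_invariant_orientation (G Z : Type*) [Group G] [MulAction G Z] :
    ∃ O : Z → Z → Prop, (∀ (g : G) x y, O x y → O (g • x) (g • y)) ∧
      (∀ x y, O x y → ¬ O y x) ∧
      ∀ x y, O x y ∨ O y x ∨ ∃ g : G, g • x = y ∧ g • y = x := by
  let q : Z → Z → MulAction.orbitRel.Quotient G (Z × Z) := fun x y => Quotient.mk _ (x, y)
  have hq : ∀ (g : G) x y, q (g • x) (g • y) = q x y := fun g x y =>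
    Quotient.sound (MulAction.orbitRel_apply.2 ⟨g, rfl⟩)
  refine ⟨fun x y => WellOrderingRel (q x y) (q y x), ?_, ?_, ?_⟩
  · intro g x y h
    rwa [hq, hq]
  · intro x y h
    exact asymm_of WellOrderingRel h
  · intro x y
    rcases trichotomous_of WellOrderingRel (q x y) (q y x) with h | h | h
    · exact Or.inl h
    · obtain ⟨g, hg⟩ := MulAction.orbitRel_apply.1 (Quotient.exact h.symm)
      obtain ⟨h1, h2⟩ := Prod.ext_iff.1 hg
      exact Or.inr (Or.inr ⟨g, h1, h2⟩)
    · exact Or.inr (Or.inl h)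

/-- If a group acts on each `4`-set it preserves through at most one pair of disjoint
transpositions, then there is an invariant semifinal relation. -/
theorem exists_invariant_semifinal
    (H : ∀ x : Fin 4 → Z, Function.Injective x → ∃ π : Equiv.Perm (Fin 4),
      ∀ (g : G) (σ : Equiv.Perm (Fin 4)), g • x = x ∘ σ → σ = 1 ∨ σ = π * rot * π⁻¹) :
    ∃ S : (Fin 4 → Z) → Prop, (∀ x, S x → Function.Injective x) ∧
      (∀ (g : G) x, S x → S (g • x)) ∧
      ∀ x : Fin 4 → Z, Function.Injective x → ∃ π : Equiv.Perm (Fin 4),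
        ∀ σ : Equiv.Perm (Fin 4), S (x ∘ σ) ↔ σ = π ∨ σ = π * rot := by
  let r : Setoid (Fin 4 → Z) :=
    { r := fun x y => ∃ (g : G) (σ : Equiv.Perm (Fin 4)), (g • x) ∘ σ = y
      iseqv :=
        { refl := fun x => ⟨1, 1, by simp⟩
          symm := by
            rintro x _ ⟨g, σ, rfl⟩
            exact ⟨g⁻¹, σ⁻¹, by funext i; simp⟩
          trans := by
            rintro x _ _ ⟨g, σ, rfl⟩ ⟨h, τ, rfl⟩
            exact ⟨h * g, σ * τ, by funext i; simp [mul_smul]⟩ } }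
  -- a representative of each orbit of `4`-sets, enumerated so that its stabilizer acts by `rot`
  have hrep : ∀ q : Quotient r, ∃ b : Fin 4 → Z, (∃ x, Quotient.mk r x = q ∧
      Function.Injective x) → Quotient.mk r b = q ∧ Function.Injective b ∧
      ∀ (g : G) (σ : Equiv.Perm (Fin 4)), g • b = b ∘ σ → σ = 1 ∨ σ = rot := by
    intro q
    by_cases hq : ∃ x, Quotient.mk r x = q ∧ Function.Injective x
    · obtain ⟨x, rfl, hx⟩ := hq
      obtain ⟨π, hπ⟩ := H x hx
      refine ⟨x ∘ π, fun _ => ⟨?_, hx.comp π.injective, ?_⟩⟩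
      · exact Quotient.sound (r.symm ⟨1, π, by simp⟩)
      · intro g σ hg
        have h1 : g • x = x ∘ (π * σ * π⁻¹ : Equiv.Perm (Fin 4)) := by
          funext i
          have := congrFun hg (π⁻¹ i)
          simpa using this
        rcases hπ g _ h1 with h | h
        · left; simpa [mul_inv_eq_one] using h
        · right; simpa using h
    · exact ⟨q.out, fun h => absurd h hq⟩
  choose B hB using hrep
  refine ⟨fun x => Function.Injective x ∧ ∃ g : G, x = g • B (Quotient.mk r x) ∨
    x = (g • B (Quotient.mk r x)) ∘ rot, fun x hx => hx.1, ?_, ?_⟩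
  · rintro g x ⟨hx, h, hh⟩
    refine ⟨(MulAction.injective g).comp hx, g * h, ?_⟩
    have : Quotient.mk r (g • x) = Quotient.mk r x :=
      Quotient.sound (r.symm ⟨g, 1, by simp⟩)
    rw [this]
    rcases hh with hh | hh
    · left; rw [mul_smul, ← hh]
    · right
      nth_rewrite 1 [hh]
      funext i; simp [mul_smul]
  · intro x hx
    obtain ⟨hBx, hBi, hBs⟩ := hB (Quotient.mk r x) ⟨x, rfl, hx⟩
    obtain ⟨h, τ, hτ⟩ : ∃ (g : G) (σ : Equiv.Perm (Fin 4)), (g • B (Quotient.mk r x)) ∘ σ = x :=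
      Quotient.exact hBx
    refine ⟨τ⁻¹, fun σ => ?_⟩
    have hσ : Quotient.mk r (x ∘ σ) = Quotient.mk r x :=
      Quotient.sound (r.symm ⟨1, σ, by simp⟩)
    beta_reduce
    rw [hσ]
    generalize B (Quotient.mk r x) = b at *
    subst hτ
    constructor
    · rintro ⟨-, g, hg | hg⟩
      · have h1 : (g⁻¹ * h) • b = b ∘ ((τ * σ)⁻¹ : Equiv.Perm (Fin 4)) := by
          funext i
          have := congrArg (fun z => g⁻¹ • z) (congrFun hg ((τ * σ)⁻¹ i))
          simpa [mul_smul] using this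
        rcases hBs _ _ h1 with h2 | h2
        · left; rw [inv_eq_one] at h2; exact eq_inv_of_mul_eq_one_right h2
        · right; rw [eq_inv_mul_iff_mul_eq, ← inv_inv (τ * σ), h2]; decide
      · have h1 : (g⁻¹ * h) • b = b ∘ (rot * (τ * σ)⁻¹ : Equiv.Perm (Fin 4)) := by
          funext i
          have := congrArg (fun z => g⁻¹ • z) (congrFun hg ((τ * σ)⁻¹ i))
          simpa [mul_smul] using this
        rcases hBs _ _ h1 with h2 | h2
        · right; rw [eq_inv_mul_iff_mul_eq]; exact (mul_inv_eq_one.1 h2).symm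
        · left
          rw [mul_eq_left, inv_eq_one] at h2
          exact eq_inv_of_mul_eq_one_right h2
    · rintro (rfl | rfl)
      · exact ⟨hx.comp (Equiv.injective _), h, Or.inl (by funext i; simp)⟩
      · exact ⟨hx.comp (Equiv.injective _), h, Or.inr (by funext i; simp)⟩

set_option maxRecDepth 20000 in
theorem perm_fin_four_cases (σ : Equiv.Perm (Fin 4)) :
    σ = 1 ∨ (∃ π : Equiv.Perm (Fin 4), σ = π * rot * π⁻¹) ∨
    (∃ i, σ (σ (σ (σ i))) = i ∧ σ (σ i) ≠ i) ∨
    (∃ i j, σ (σ (σ i)) = i ∧ σ i ≠ i ∧ σ j = j) ∨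
    ∃ i j k, σ (σ i) = i ∧ σ i ≠ i ∧ σ j = j ∧ σ k = k ∧ j ≠ k := by
  revert σ
  decide

set_option maxRecDepth 20000 in
theorem double_transpositions_swap (σ τ : Equiv.Perm (Fin 4)) (h1 : ∀ i, σ i ≠ i)
    (h2 : ∀ i, σ (σ i) = i) (h3 : ∀ i, τ i ≠ i) (h4 : ∀ i, τ (τ i) = i) (h : σ ≠ τ) :
    σ 0 ≠ τ 0 ∧ σ (τ (σ 0)) = τ 0 ∧ σ (τ (τ 0)) = σ 0 := by
  revert σ τ
  decide

/-- If a group acts tamely and no three points are pairwise interchanged by its elements, then it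
acts on each `4`-set it preserves through at most one pair of disjoint transpositions. -/
theorem TameAction.exists_conj_rot (hT : TameAction G Z)
    (h3 : ∀ x y z : Z, x ≠ y → x ≠ z → y ≠ z → (∃ g : G, g • x = y ∧ g • y = x) →
      (∃ g : G, g • x = z ∧ g • z = x) → ¬ ∃ g : G, g • y = z ∧ g • z = y)
    (x : Fin 4 → Z) (hx : Function.Injective x) :
    ∃ π : Equiv.Perm (Fin 4), ∀ (g : G) (σ : Equiv.Perm (Fin 4)), g • x = x ∘ σ →
      σ = 1 ∨ σ = π * rot * π⁻¹ := by
  have key : ∀ (g : G) (σ : Equiv.Perm (Fin 4)), g • x = x ∘ σ →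
      σ = 1 ∨ ∃ π : Equiv.Perm (Fin 4), σ = π * rot * π⁻¹ := by
    intro g σ hg
    have hg' : ∀ i, g • x i = x (σ i) := congrFun hg
    rcases perm_fin_four_cases σ with h | h | ⟨i, h1, h2⟩ | ⟨i, j, h1, h2, h3⟩ |
      ⟨i, j, k, h1, h2, h3, h4, h5⟩
    · exact Or.inl h
    · exact Or.inr h
    · have := hT.no_four g (x i) (by simp only [hg', h1])
      simp only [hg'] at this
      exact absurd (hx this) h2
    · have := hT.no_three g (x i) (x j) (by simp only [hg', h1]) (by simp only [hg', h3])
      simp only [hg'] at this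
      exact absurd (hx this) h2
    · have := hT.no_two g (x i) (x j) (x k) (by simp only [hg', h1]) (by simp only [hg', h3])
        (by simp only [hg', h4]) (hx.ne h5)
      simp only [hg'] at this
      exact absurd (hx this) h2
  by_cases hex : ∃ (g : G) (σ : Equiv.Perm (Fin 4)), g • x = x ∘ σ ∧ σ ≠ 1
  · obtain ⟨g, σ, hg, hσ⟩ := hex
    obtain ⟨π, rfl⟩ := (key g σ hg).resolve_left hσ
    refine ⟨π, fun h τ hh => ?_⟩
    rcases key h τ hh with h1 | ⟨ρ, rfl⟩
    · exact Or.inl h1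
    · right
      by_contra hne
      have hsw := double_transpositions_swap _ _ (conj_rot_apply_ne π) (conj_rot_apply_apply π)
        (conj_rot_apply_ne ρ) (conj_rot_apply_apply ρ) (Ne.symm hne)
      have e1 := conj_rot_apply_ne π 0
      have e2 := conj_rot_apply_ne ρ 0
      have e3 := conj_rot_apply_apply π 0
      have e4 := conj_rot_apply_apply ρ 0
      generalize π * rot * π⁻¹ = σ at *
      generalize ρ * rot * ρ⁻¹ = τ at *
      have hg' : ∀ i, g • x i = x (σ i) := congrFun hg
      have hh' : ∀ i, h • x i = x (τ i) := congrFun hh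
      refine h3 (x 0) (x (σ 0)) (x (τ 0)) (hx.ne e1.symm) (hx.ne e2.symm) (hx.ne hsw.1)
        ⟨g, hg' 0, by rw [hg', e3]⟩ ⟨h, hh' 0, by rw [hh', e4]⟩ ⟨g * h, ?_, ?_⟩
      · rw [mul_smul, hh', hg', hsw.2.1]
      · rw [mul_smul, hh', hg', hsw.2.2]
  · refine ⟨1, fun g σ hg => Or.inl ?_⟩
    by_contra hσ
    exact hex ⟨g, σ, hg, hσ⟩

end Choices

/-! ### Good tuples -/

section Good

variable (G : Type*) {X : Type*} [Group G] [MulAction G X]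

/-- The tuple `c` is good for `x` if no group element that fixes `x` acts on the entries of `c` as
a nontrivial involution. -/
def IsGood {m : ℕ} (c : Fin m → X) (x : X) : Prop :=
  ∀ g : G, g • x = x → g • g • c = c → g • c = c

variable (X) in
/-- Each point has a good tuple with at least two distinct entries. -/
def HasGoodTuples : Prop :=
  ∀ x : X, ∃ (m : ℕ) (c : Fin m → X), (∃ i j, c i ≠ c j) ∧ IsGood G c x

variable {G}

theorem IsGood.smul {m : ℕ} {c : Fin m → X} {x : X} (h : IsGood G c x) (k : G) :
    IsGood G (k • c) (k • x) := by
  intro g hx hc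
  have h1 := h (k⁻¹ * g * k) (by simp [mul_smul, hx]) (by simp [mul_smul, hc])
  rw [mul_assoc, mul_smul, inv_smul_eq_iff, mul_smul] at h1
  exact h1

/-- An element that moves an entry of `c'` and fixes `c` would have two fixed points besides a
`2`-cycle. -/
theorem IsGood.mono (hT : TameAction G X) {m n : ℕ} {c : Fin m → X} {c' : Fin n → X} {x : X}
    (h : IsGood G c x) (hc : ∃ i j, c i ≠ c j) (hcc : ∀ i, ∃ j, c' j = c i) :
    IsGood G c' x := by
  intro g hx hg
  have hgc : g • c = c := by
    apply h g hx
    funext i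
    obtain ⟨j, hj⟩ := hcc i
    simpa [hj] using congrFun hg j
  obtain ⟨i, j, hij⟩ := hc
  funext k
  exact hT.no_two g (c' k) (c i) (c j) (congrFun hg k) (congrFun hgc i) (congrFun hgc j) hij

/-- Every finite tuple is contained in one that is good for its entries and for one of the entries
of the larger tuple. -/
theorem HasGoodTuples.exists_anchor [Nonempty X] (h : HasGoodTuples G X) (hT : TameAction G X)
    {n : ℕ} (b : Fin n → X) : ∃ (m : ℕ) (c : Fin m → X), (∀ i, ∃ j, c j = b i) ∧
      (∃ i j, c i ≠ c j) ∧ (∀ i, IsGood G c (b i)) ∧ ∃ j, IsGood G c (c j) := by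
  classical
  choose m c hne hgood using h
  obtain ⟨x⟩ := ‹Nonempty X›
  let t : Finset X := insert x (Finset.univ.image b)
  let s : Finset X := t ∪ t.biUnion fun y => Finset.univ.image (c y)
  let d : Fin s.card → X := fun i => (s.equivFin.symm i : X)
  have hd : ∀ y ∈ s, ∃ j, d j = y := fun y hy => ⟨s.equivFin ⟨y, hy⟩, by simp [d]⟩
  have hts : ∀ y ∈ t, y ∈ s := fun y hy => Finset.mem_union_left _ hy
  have hcs : ∀ y ∈ t, ∀ i, ∃ j, d j = c y i := fun y hy i =>
    hd _ (Finset.mem_union_right _ (Finset.mem_biUnion.2 ⟨y, hy, by simp⟩))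
  have hg : ∀ y ∈ t, IsGood G d y := fun y hy => (hgood y).mono hT (hne y) (hcs y hy)
  have hb : ∀ i, b i ∈ t := fun i => by simp [t]
  have hx : x ∈ t := by simp [t]
  refine ⟨_, d, fun i => hd _ (hts _ (hb i)), ?_, fun i => hg _ (hb i), ?_⟩
  · obtain ⟨i, j, hij⟩ := hne x
    obtain ⟨i', hi'⟩ := hcs x hx i
    obtain ⟨j', hj'⟩ := hcs x hx j
    exact ⟨i', j', by rwa [hi', hj']⟩
  · obtain ⟨j, hj⟩ := hd x (hts _ hx)
    exact ⟨j, by rw [hj]; exact hg x hx⟩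

end Good

/-! ### Adding a point for every type over a finite set -/

/-- A point to be added to `X`. It realizes over the finite set enumerated by `base` the type given
by a structure on `Option (Fin n)`, in which `none` stands for the new point. The group acts on such
points through `base` and `anchor`; as the entries of `base` are among those of `anchor`, the
stabilizer of the point is the pointwise stabilizer of `anchor`. -/
structure NewPoint (G X : Type*) [Group G] [MulAction G X] [lang.Structure X] where
  /-- the size of the base -/
  n : ℕ
  /-- the length of the anchor -/
  m : ℕ
  /-- an enumeration of the finite set over which the type is realized -/
  base : Fin n → X
  /-- the tuple that determines the stabilizer -/
  anchor : Fin m → X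
  /-- the edges of the type -/
  E : Option (Fin n) → Option (Fin n) → Prop
  /-- the relation `S` of the type -/
  S : (Fin 4 → Option (Fin n)) → Prop
  base_injective : Function.Injective base
  base_mem : ∀ i, ∃ j, anchor j = base i
  anchor_ne : ∃ i j, anchor i ≠ anchor j
  isLocallyD : @IsLocallyD (Option (Fin n)) (mkStructure E S)
  edge_base : ∀ i j, E (some i) (some j) ↔ edge (base i) (base j)
  semi_base : ∀ x : Fin 4 → Fin n, S (some ∘ x) ↔ semi (base ∘ x)
  good_base : ∀ i, ¬ E none (some i) → ¬ E (some i) none → IsGood G anchor (base i)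
  good_anchor : ∃ j, IsGood G anchor (anchor j)

namespace NewPoint

variable {G X : Type*} [Group G] [MulAction G X] [lang.Structure X]

instance {G X : Type} [Group G] [MulAction G X] [lang.Structure X] [Countable X] :
    Countable (NewPoint G X) := by
  let f : NewPoint G X → Σ nm : ℕ × ℕ, (Fin nm.1 → X) × (Fin nm.2 → X) ×
      (Option (Fin nm.1) → Option (Fin nm.1) → Prop) × ((Fin 4 → Option (Fin nm.1)) → Prop) :=
    fun p => ⟨(p.n, p.m), p.base, p.anchor, p.E, p.S⟩
  have hf : Function.Injective f := by
    rintro ⟨n, m, b, c, E, S⟩ ⟨n', m', b', c', E', S'⟩ h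
    obtain ⟨h1, h2⟩ := Sigma.mk.inj_iff.1 h
    obtain ⟨rfl, rfl⟩ : n = n' ∧ m = m' := by simpa using h1
    obtain ⟨rfl, rfl, rfl, rfl⟩ : b = b' ∧ c = c' ∧ E = E' ∧ S = S' := by
      simpa using h2
    rfl
  exact hf.countable

instance (p : NewPoint G X) : lang.Structure (Option (Fin p.n)) := mkStructure p.E p.S

variable [ActsByAut G X]

instance : SMul G (NewPoint G X) where
  smul g p :=
    { n := p.n
      m := p.m
      base := g • p.base
      anchor := g • p.anchor
      E := p.E
      S := p.S
      base_injective := (MulAction.injective g).comp p.base_injective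
      base_mem := fun i => by
        obtain ⟨j, hj⟩ := p.base_mem i
        exact ⟨j, by simp [hj]⟩
      anchor_ne := by
        obtain ⟨i, j, h⟩ := p.anchor_ne
        exact ⟨i, j, by simpa using h⟩
      isLocallyD := p.isLocallyD
      edge_base := fun i j => by
        rw [p.edge_base]
        exact (ActsByAut.edge_smul g _ _).symm
      semi_base := fun x => by
        rw [p.semi_base]
        exact (ActsByAut.semi_smul g _).symm
      good_base := fun i h1 h2 => (p.good_base i h1 h2).smul g
      good_anchor := by
        obtain ⟨j, hj⟩ := p.good_anchor
        exact ⟨j, hj.smul g⟩ }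

theorem smul_def (g : G) (p : NewPoint G X) (b : Fin p.n → X) (c : Fin p.m → X) (hb : b = g • p.base)
    (hc : c = g • p.anchor) (h1 h2 h3 h4 h5 h6 h7 h8) :
    g • p = ⟨p.n, p.m, b, c, p.E, p.S, h1, h2, h3, h4, h5, h6, h7, h8⟩ := by
  subst hb hc
  rfl

instance : MulAction G (NewPoint G X) where
  one_smul p := by
    rw [smul_def 1 p p.base p.anchor (by simp) (by simp)]
  mul_smul g h p := by
    rw [smul_def (g * h) p (g • h • p.base) (g • h • p.anchor) (by simp [mul_smul])
      (by simp [mul_smul])]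
    rfl

theorem smul_eq_iff (g : G) (p : NewPoint G X) : g • p = p ↔ g • p.anchor = p.anchor := by
  constructor
  · intro h
    have : HEq (g • p).anchor p.anchor := by rw [h]
    exact eq_of_heq this
  · intro h
    have hb : p.base = g • p.base := by
      funext i
      obtain ⟨j, hj⟩ := p.base_mem i
      simpa [hj] using (congrFun h j).symm
    rw [smul_def g p p.base p.anchor hb h.symm]

theorem smul_smul_eq_iff (g : G) (p : NewPoint G X) :
    g • g • p = p ↔ g • g • p.anchor = p.anchor := by
  rw [smul_smul, smul_smul, smul_eq_iff]

end NewPoint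

/-! ### The one-step extension -/

section Extension

variable {G X : Type*} [Group G] [MulAction G X] [lang.Structure X]

/-- The realization of the type of a new point. -/
def NewPoint.emb (p : NewPoint G X) : Option (Fin p.n) → X ⊕ NewPoint G X
  | none => Sum.inr p
  | some i => Sum.inl (p.base i)

theorem NewPoint.emb_injective (p : NewPoint G X) : Function.Injective p.emb := by
  rintro (_ | i) (_ | j) h
  · rfl
  · simp [emb] at h
  · simp [emb] at h
  · simp only [emb, Sum.inl.injEq] at h
    rw [p.base_injective h]

/-- Edges of the extension: a new point sends edges to all old points outside its base, and edges
between new points are given by the orientation `O`. -/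
def extEdge (O : NewPoint G X → NewPoint G X → Prop) :
    X ⊕ NewPoint G X → X ⊕ NewPoint G X → Prop
  | Sum.inl a, Sum.inl b => edge a b
  | Sum.inr p, Sum.inl a => (∃ i, p.base i = a ∧ p.E none (some i)) ∨ ∀ i, p.base i ≠ a
  | Sum.inl a, Sum.inr p => ∃ i, p.base i = a ∧ p.E (some i) none
  | Sum.inr p, Sum.inr q => O p q

/-- The relation `S` of the extension is given on old points and on the types of new points, and
by `S₀` on all other `4`-sets. -/
def extSemi (S₀ : (Fin 4 → X ⊕ NewPoint G X) → Prop) (x : Fin 4 → X ⊕ NewPoint G X) : Prop :=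
  (∃ y : Fin 4 → X, x = Sum.inl ∘ y ∧ semi y) ∨ (∃ p y, x = NewPoint.emb p ∘ y ∧ p.S y) ∨
    ((¬ ∃ y : Fin 4 → X, x = Sum.inl ∘ y) ∧ (¬ ∃ p y, x = NewPoint.emb p ∘ y) ∧ S₀ x)

variable {S₀ : (Fin 4 → X ⊕ NewPoint G X) → Prop} {O : NewPoint G X → NewPoint G X → Prop}

theorem exists_some_comp {n : ℕ} (y : Fin 4 → Option (Fin n)) (h : ∀ i, y i ≠ none) :
    ∃ z : Fin 4 → Fin n, y = some ∘ z := by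
  choose z hz using fun i => Option.ne_none_iff_exists'.1 (h i)
  exact ⟨z, funext hz⟩

theorem extSemi_inl (y : Fin 4 → X) : extSemi S₀ (Sum.inl ∘ y) ↔ semi y := by
  constructor
  · rintro (⟨z, hz, hs⟩ | ⟨p, z, hz, hs⟩ | ⟨h, -, -⟩)
    · rwa [Sum.inl_injective.comp_left hz]
    · obtain ⟨w, rfl⟩ := exists_some_comp z (fun i hi => by
        have := congrFun hz i
        simp [hi, NewPoint.emb] at this)
      rw [p.semi_base] at hs
      have : y = p.base ∘ w := Sum.inl_injective.comp_left hz
      rwa [this]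
    · exact absurd ⟨y, rfl⟩ h
  · exact fun h => Or.inl ⟨y, rfl, h⟩

theorem extSemi_emb (p : NewPoint G X) (y : Fin 4 → Option (Fin p.n)) :
    extSemi S₀ (p.emb ∘ y) ↔ p.S y := by
  by_cases hy : ∀ i, y i ≠ none
  · obtain ⟨w, rfl⟩ := exists_some_comp y hy
    rw [p.semi_base]
    exact extSemi_inl (p.base ∘ w)
  · push Not at hy
    obtain ⟨i, hi⟩ := hy
    constructor
    · rintro (⟨z, hz, -⟩ | ⟨q, z, hz, hs⟩ | ⟨-, h, -⟩)
      · have := congrFun hz i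
        simp [hi, NewPoint.emb] at this
      · have : q.emb (z i) = Sum.inr p := by
          have := congrFun hz i
          simpa [hi, NewPoint.emb] using this.symm
        have hqp : q = p := by
          rcases h : z i with _ | j
          · simpa [h, NewPoint.emb] using this
          · simp [h, NewPoint.emb] at this
        subst hqp
        rwa [q.emb_injective.comp_left hz]
      · exact absurd ⟨p, y, rfl⟩ h
    · exact fun h => Or.inr (Or.inl ⟨p, y, rfl, h⟩)

theorem extSemi_of_not {x : Fin 4 → X ⊕ NewPoint G X} (h1 : ¬ ∃ y : Fin 4 → X, x = Sum.inl ∘ y)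
    (h2 : ¬ ∃ p y, x = NewPoint.emb p ∘ y) : extSemi S₀ x ↔ S₀ x := by
  constructor
  · rintro (⟨y, hy, -⟩ | ⟨p, y, hy, -⟩ | h)
    · exact absurd ⟨y, hy⟩ h1
    · exact absurd ⟨p, y, hy⟩ h2
    · exact h.2.2
  · exact fun h => Or.inr (Or.inr ⟨h1, h2, h⟩)

theorem extEdge_emb (hO : ∀ p q, O p q → ¬ O q p) (p : NewPoint G X) (i j : Option (Fin p.n)) :
    extEdge O (p.emb i) (p.emb j) ↔ p.E i j := by
  have hO' : ¬ O p p := fun h => hO p p h h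
  have hE : ¬ p.E none none := fun h => p.isLocallyD.asymm none none h h
  rcases i with _ | i <;> rcases j with _ | j
  · simp [extEdge, NewPoint.emb, hO', hE]
  · simp only [NewPoint.emb, extEdge]
    constructor
    · rintro (⟨k, hk, h⟩ | h)
      · rwa [← p.base_injective hk]
      · exact absurd rfl (h j)
    · exact fun h => Or.inl ⟨j, rfl, h⟩
  · simp only [NewPoint.emb, extEdge]
    constructor
    · rintro ⟨k, hk, h⟩
      rwa [← p.base_injective hk]
    · exact fun h => ⟨i, rfl, h⟩
  · exact (p.edge_base i j).symm

theorem extEdge_asymm (hX : IsLocallyD X) (hO : ∀ p q, O p q → ¬ O q p)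
    (x y : X ⊕ NewPoint G X) : extEdge O x y → ¬ extEdge O y x := by
  have key : ∀ (p : NewPoint G X) (a : X),
      extEdge O (Sum.inr p) (Sum.inl a) → ¬ extEdge O (Sum.inl a) (Sum.inr p) := by
    rintro p a h ⟨i, rfl, hi⟩
    rcases h with ⟨j, hj, h⟩ | h
    · rw [p.base_injective hj] at h
      exact p.isLocallyD.asymm _ _ h hi
    · exact h i rfl
  rcases x with a | p <;> rcases y with b | q
  · exact hX.asymm a b
  · exact fun h h' => key q a h' h
  · exact key p b
  · exact hO p q

variable [ActsByAut G X]

theorem tameAction_ext (hT : TameAction G X) : TameAction G (X ⊕ NewPoint G X) := by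
  -- a nontrivial cycle of new points gives one of old points, of the same kind
  have h2 : ∀ (g : G) (x : X ⊕ NewPoint G X), g • g • x = x → g • x ≠ x →
      ∃ a : X, g • g • a = a ∧ g • a ≠ a := by
    rintro g (a | p) h hne
    · exact ⟨a, by simpa using h, by simpa using hne⟩
    · simp only [Sum.smul_inr, Sum.inr.injEq, ne_eq, NewPoint.smul_eq_iff] at h hne
      obtain ⟨i, hi⟩ := Function.ne_iff.1 hne
      rw [smul_smul, NewPoint.smul_eq_iff] at h
      exact ⟨p.anchor i, by simpa [mul_smul] using congrFun h i, hi⟩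
  have h3 : ∀ (g : G) (x : X ⊕ NewPoint G X), g • g • g • x = x → g • x ≠ x →
      ∃ a : X, g • g • g • a = a ∧ g • a ≠ a := by
    rintro g (a | p) h hne
    · exact ⟨a, by simpa using h, by simpa using hne⟩
    · simp only [Sum.smul_inr, Sum.inr.injEq, ne_eq, NewPoint.smul_eq_iff] at h hne
      obtain ⟨i, hi⟩ := Function.ne_iff.1 hne
      rw [smul_smul, smul_smul, NewPoint.smul_eq_iff] at h
      exact ⟨p.anchor i, by simpa [mul_smul] using congrFun h i, hi⟩
  have hfix : ∀ (g : G) (p : NewPoint G X), g • (Sum.inr p : X ⊕ NewPoint G X) = Sum.inr p →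
      ∃ a b : X, a ≠ b ∧ g • a = a ∧ g • b = b := by
    intro g p h
    simp only [Sum.smul_inr, Sum.inr.injEq, NewPoint.smul_eq_iff] at h
    obtain ⟨i, j, hij⟩ := p.anchor_ne
    exact ⟨_, _, hij, congrFun h i, congrFun h j⟩
  refine ⟨?_, ?_, ?_⟩
  · rintro g (a | p) h
    · simp only [Sum.smul_inl, Sum.inl.injEq] at h ⊢
      exact hT.no_four g a h
    · simp only [Sum.smul_inr, Sum.inr.injEq] at h ⊢
      rw [NewPoint.smul_smul_eq_iff]
      rw [smul_smul, smul_smul, smul_smul, NewPoint.smul_eq_iff] at h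
      funext i
      exact hT.no_four g _ (by simpa [mul_smul] using congrFun h i)
  · intro g x y hx hy
    by_contra hne
    obtain ⟨a, ha, hane⟩ := h3 g x hx hne
    rcases y with b | p
    · exact hane (hT.no_three g a b ha (by simpa using hy))
    · obtain ⟨b, -, -, hb, -⟩ := hfix g p hy
      exact hane (hT.no_three g a b ha hb)
  · intro g x y z hx hy hz hyz
    by_contra hne
    obtain ⟨a, ha, hane⟩ := h2 g x hx hne
    rcases y with b | p
    · rcases z with c | p
      · exact hane (hT.no_two g a b c ha (by simpa using hy) (by simpa using hz)
          (fun h => hyz (by rw [h])))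
      · obtain ⟨b, c, hbc, hb, hc⟩ := hfix g p hz
        exact hane (hT.no_two g a b c ha hb hc hbc)
    · obtain ⟨b, c, hbc, hb, hc⟩ := hfix g p hy
      exact hane (hT.no_two g a b c ha hb hc hbc)

/-- The extension is `I₃`-free if `O` orients all pairs of new points that are not interchanged by
a group element. For a new point `p` interchanged with `g • p`, this rests on the goodness of
its anchor. -/
theorem ext_i3_free (hX : IsLocallyD X)
    (htot : ∀ p q : NewPoint G X, O p q ∨ O q p ∨ ∃ g : G, g • p = q ∧ g • q = p)
    (x y z : X ⊕ NewPoint G X) (hxy : x ≠ y) (hxz : x ≠ z) (hyz : y ≠ z)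
    (h1 : ¬ (extEdge O x y ∨ extEdge O y x)) (h2 : ¬ (extEdge O x z ∨ extEdge O z x)) :
    extEdge O y z ∨ extEdge O z y := by
  by_contra h3
  have hbase : ∀ (a : X) (p : NewPoint G X),
      ¬ (extEdge O (Sum.inl a) (Sum.inr p) ∨ extEdge O (Sum.inr p) (Sum.inl a)) →
      ∃ i, p.base i = a ∧ ¬ p.E none (some i) ∧ ¬ p.E (some i) none := by
    intro a p h
    simp only [extEdge, not_or, not_forall, not_not] at h
    obtain ⟨h4, h5, i, hi⟩ := h
    exact ⟨i, hi, fun h => h5 ⟨i, hi, h⟩, fun h => h4 ⟨i, hi, h⟩⟩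
  -- one new point
  have one : ∀ (a b : X) (p : NewPoint G X), a ≠ b → ¬ adj a b →
      ¬ (extEdge O (Sum.inl a) (Sum.inr p) ∨ extEdge O (Sum.inr p) (Sum.inl a)) →
      ¬ (extEdge O (Sum.inl b) (Sum.inr p) ∨ extEdge O (Sum.inr p) (Sum.inl b)) → False := by
    intro a b p hab hn ha hb
    obtain ⟨i, rfl, hi⟩ := hbase a p ha
    obtain ⟨j, rfl, hj⟩ := hbase b p hb
    have hij : i ≠ j := fun h => hab (by rw [h])
    rcases p.isLocallyD.i3_free none (some i) (some j) (by simp) (by simp) (by simpa using hij)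
      with (h | h) | (h | h) | h
    · exact hi.1 h
    · exact hi.2 h
    · exact hj.1 h
    · exact hj.2 h
    · exact hn (h.imp (p.edge_base _ _).1 (p.edge_base _ _).1)
  have hswap : ∀ p q : NewPoint G X, p ≠ q → ¬ (extEdge O (Sum.inr p) (Sum.inr q) ∨
      extEdge O (Sum.inr q) (Sum.inr p)) → ∃ g : G, q = g • p ∧ g • g • p = p ∧
      g • p.anchor ≠ p.anchor := by
    intro p q hpq h
    rcases htot p q with h' | h' | ⟨g, rfl, hg⟩
    · exact absurd (Or.inl h') h
    · exact absurd (Or.inr h') h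
    · exact ⟨g, rfl, hg, fun h => hpq ((NewPoint.smul_eq_iff g p).2 h).symm⟩
  -- two new points
  have two : ∀ (a : X) (p q : NewPoint G X), p ≠ q →
      ¬ (extEdge O (Sum.inr p) (Sum.inr q) ∨ extEdge O (Sum.inr q) (Sum.inr p)) →
      ¬ (extEdge O (Sum.inl a) (Sum.inr p) ∨ extEdge O (Sum.inr p) (Sum.inl a)) →
      ¬ (extEdge O (Sum.inl a) (Sum.inr q) ∨ extEdge O (Sum.inr q) (Sum.inl a)) → False := by
    intro a p q hpq hn hp hq
    obtain ⟨g, rfl, hg, hne⟩ := hswap p q hpq hn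
    obtain ⟨i, rfl, hi⟩ := hbase a p hp
    obtain ⟨j, hj, hj'⟩ := hbase _ _ hq
    rw [NewPoint.smul_smul_eq_iff] at hg
    have hgb : ∀ k, g • g • p.base k = p.base k := by
      intro k
      obtain ⟨l, hl⟩ := p.base_mem k
      rw [← hl]
      exact congrFun hg l
    have hj : g • p.base j = p.base i := hj
    by_cases hij : i = j
    · subst hij
      exact hne (p.good_base i hi.1 hi.2 g hj hg)
    · have hsw : g • p.base i = p.base j := by rw [← hj, hgb]
      rcases p.isLocallyD.i3_free none (some i) (some j) (by simp) (by simp) (by simpa using hij)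
        with (h | h) | (h | h) | h
      · exact hi.1 h
      · exact hi.2 h
      · exact hj'.1 h
      · exact hj'.2 h
      · exact not_adj_of_swap (G := G) hX hsw hj (h.imp (p.edge_base _ _).1 (p.edge_base _ _).1)
  -- three new points
  have three : ∀ (p q r : NewPoint G X), p ≠ q → p ≠ r → q ≠ r →
      ¬ (extEdge O (Sum.inr p) (Sum.inr q) ∨ extEdge O (Sum.inr q) (Sum.inr p)) →
      ¬ (extEdge O (Sum.inr p) (Sum.inr r) ∨ extEdge O (Sum.inr r) (Sum.inr p)) →
      ¬ (extEdge O (Sum.inr q) (Sum.inr r) ∨ extEdge O (Sum.inr r) (Sum.inr q)) → False := by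
    intro p q r hpq hpr hqr npq npr nqr
    obtain ⟨g, rfl, hg, hgne⟩ := hswap p q hpq npq
    obtain ⟨h, rfl, hh, hhne⟩ := hswap p r hpr npr
    obtain ⟨k, hk, hkk, hkne⟩ := hswap _ _ hqr nqr
    rw [NewPoint.smul_smul_eq_iff] at hg hh
    obtain ⟨i, hi⟩ := p.good_anchor
    have hka : h • p.anchor = k • g • p.anchor := by
      have : HEq (h • p).anchor (k • g • p).anchor := by rw [hk]
      exact eq_of_heq this
    have hkka : k • k • g • p.anchor = g • p.anchor := by
      rw [NewPoint.smul_smul_eq_iff] at hkk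
      exact hkk
    have e1 : g • p.anchor i ≠ p.anchor i := fun e => hgne (hi g e hg)
    have e2 : h • p.anchor i ≠ p.anchor i := fun e => hhne (hi h e hh)
    have e3 : k • g • p.anchor i ≠ g • p.anchor i := fun e => hkne ((hi.smul g) k e hkka)
    have hki : h • p.anchor i = k • g • p.anchor i := congrFun hka i
    have hkki : k • k • g • p.anchor i = g • p.anchor i := congrFun hkka i
    rcases hX.i3_free (p.anchor i) (g • p.anchor i) (h • p.anchor i) e1.symm e2.symm
      (by rw [hki]; exact e3.symm) with h | h | h
    · exact not_adj_of_swap hX rfl (congrFun hg i) h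
    · exact not_adj_of_swap hX rfl (congrFun hh i) h
    · rw [hki] at h
      exact not_adj_of_swap hX rfl hkki h
  rw [or_comm] at h1 h2 h3
  rcases x with a | p <;> rcases y with b | q <;> rcases z with c | r
  · rw [or_comm] at h1 h2 h3
    rcases hX.i3_free a b c (fun h => hxy (by rw [h])) (fun h => hxz (by rw [h]))
      (fun h => hyz (by rw [h])) with h | h | h
    · exact h1 h
    · exact h2 h
    · exact h3 h
  · exact one a b r (fun h => hxy (by rw [h])) (by rwa [adj_comm]) (by rwa [or_comm])
      (by rwa [or_comm])
  · exact one a c q (fun h => hxz (by rw [h])) (by rwa [adj_comm]) (by rwa [or_comm]) h3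
  · exact two a q r (fun h => hyz (by rw [h])) (by rwa [or_comm]) (by rwa [or_comm])
      (by rwa [or_comm])
  · exact one b c p (fun h => hyz (by rw [h])) (by rwa [adj_comm]) h1 h2
  · exact two b p r (fun h => hxz (by rw [h])) (by rwa [or_comm]) h1 (by rwa [or_comm])
  · exact two c p q (fun h => hxy (by rw [h])) (by rwa [or_comm]) h2 h3
  · exact three p q r (fun h => hxy (by rw [h])) (fun h => hxz (by rw [h]))
      (fun h => hyz (by rw [h])) (by rwa [or_comm]) (by rwa [or_comm]) (by rwa [or_comm])

theorem extEdge_smul (hO : ∀ (g : G) p q, O p q → O (g • p) (g • q)) (g : G)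
    (x y : X ⊕ NewPoint G X) (h : extEdge O x y) : extEdge O (g • x) (g • y) := by
  rcases x with a | p <;> rcases y with b | q
  · exact (ActsByAut.edge_smul g a b).2 h
  · obtain ⟨i, rfl, h⟩ := h
    exact ⟨i, rfl, h⟩
  · rcases h with ⟨i, rfl, h⟩ | h
    · exact Or.inl ⟨i, rfl, h⟩
    · exact Or.inr fun i hi => h i (MulAction.injective g hi)
  · exact hO g p q h

theorem smul_emb (g : G) (p : NewPoint G X) (i : Option (Fin p.n)) :
    g • p.emb i = (g • p).emb i := by
  rcases i with _ | i <;> rfl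

theorem extSemi_smul (hS : ∀ (g : G) x, S₀ x → S₀ (g • x)) (g : G)
    (x : Fin 4 → X ⊕ NewPoint G X) (h : extSemi S₀ x) : extSemi S₀ (g • x) := by
  rcases h with ⟨y, rfl, h⟩ | ⟨p, y, rfl, h⟩ | ⟨h1, h2, h⟩
  · exact Or.inl ⟨g • y, rfl, (ActsByAut.semi_smul g y).2 h⟩
  · exact Or.inr (Or.inl ⟨g • p, y, funext fun i => smul_emb g p (y i), h⟩)
  · refine Or.inr (Or.inr ⟨?_, ?_, hS g x h⟩)
    · rintro ⟨y, hy⟩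
      refine h1 ⟨g⁻¹ • y, ?_⟩
      rw [← inv_smul_smul g x, hy]
      rfl
    · rintro ⟨p, y, hy⟩
      refine h2 ⟨g⁻¹ • p, y, ?_⟩
      rw [← inv_smul_smul g x, hy]
      exact funext fun i => smul_emb g⁻¹ p (y i)

/-- An old point keeps its good tuple, and the anchor of a new point is good for it. -/
theorem hasGoodTuples_ext (h : HasGoodTuples G X) : HasGoodTuples G (X ⊕ NewPoint G X) := by
  have key : ∀ {m : ℕ} (c : Fin m → X) (g : G),
      g • (Sum.inl ∘ c : Fin m → X ⊕ NewPoint G X) = Sum.inl ∘ (g • c) := fun c g => rfl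
  have inj : ∀ {m : ℕ} {c d : Fin m → X},
      (Sum.inl ∘ c : Fin m → X ⊕ NewPoint G X) = Sum.inl ∘ d ↔ c = d :=
    Sum.inl_injective.comp_left.eq_iff
  rintro (a | p)
  · obtain ⟨m, c, ⟨i, j, hij⟩, hc⟩ := h a
    refine ⟨m, Sum.inl ∘ c, ⟨i, j, by simpa using hij⟩, fun g hg hgg => ?_⟩
    rw [key, key, inj] at hgg
    rw [key, inj]
    exact hc g (by simpa using hg) hgg
  · obtain ⟨i, j, hij⟩ := p.anchor_ne
    refine ⟨p.m, Sum.inl ∘ p.anchor, ⟨i, j, by simpa using hij⟩, fun g hg _ => ?_⟩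
    rw [key, inj, ← NewPoint.smul_eq_iff]
    simpa using hg

/-- One step of the construction: a structure of the class with a tame group action extends, with
the action, so that all types over finite subsets are realized by new points. -/
theorem exists_extension [Nonempty X] (hX : IsLocallyD X) (hgood : HasGoodTuples G X) :
    ∃ _ : lang.Structure (X ⊕ NewPoint G X),
      ActsByAut G (X ⊕ NewPoint G X) ∧ IsLocallyD (X ⊕ NewPoint G X) ∧
      (∀ a b : X, edge (Sum.inl a : X ⊕ NewPoint G X) (Sum.inl b) ↔ edge a b) ∧
      (∀ y : Fin 4 → X, semi (Sum.inl ∘ y : Fin 4 → X ⊕ NewPoint G X) ↔ semi y) ∧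
      ∀ (n : ℕ) (b : Fin n → X) (E : Option (Fin n) → Option (Fin n) → Prop)
        (S : (Fin 4 → Option (Fin n)) → Prop), Function.Injective b →
        @IsLocallyD (Option (Fin n)) (mkStructure E S) →
        (∀ i j, E (some i) (some j) ↔ edge (b i) (b j)) →
        (∀ x : Fin 4 → Fin n, S (some ∘ x) ↔ semi (b ∘ x)) →
        ∃ f : Option (Fin n) → X ⊕ NewPoint G X, Function.Injective f ∧
          (∀ i, f (some i) = Sum.inl (b i)) ∧ (∀ a, f none ≠ Sum.inl a) ∧
          (∀ i j, edge (f i) (f j) ↔ E i j) ∧ ∀ x, semi (f ∘ x) ↔ S x := by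
  have hT := tameAction (G := G) hX
  obtain ⟨O, hO, hO', htot⟩ := exists_invariant_orientation G (NewPoint G X)
  have hi3 := ext_i3_free hX htot
  have hasymm := extEdge_asymm hX hO'
  have hnswap : ∀ x y : X ⊕ NewPoint G X, (∃ g : G, g • x = y ∧ g • y = x) →
      ¬ (extEdge O x y ∨ extEdge O y x) := by
    rintro x y ⟨g, h1, h2⟩ h
    have k1 : extEdge O x y → extEdge O y x := fun h => by
      have := extEdge_smul hO g x y h
      rwa [h1, h2] at this
    have k2 : extEdge O y x → extEdge O x y := fun h => by
      have := extEdge_smul hO g y x h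
      rwa [h1, h2] at this
    rcases h with h | h
    · exact hasymm x y h (k1 h)
    · exact hasymm y x h (k2 h)
  obtain ⟨S₀, hSi, hSs, hSf⟩ := exists_invariant_semifinal (G := G)
    ((tameAction_ext hT).exists_conj_rot fun x y z hxy hxz hyz h1 h2 h3 =>
      hnswap y z h3 (hi3 x y z hxy hxz hyz (hnswap x y h1) (hnswap x z h2)))
  let : lang.Structure (X ⊕ NewPoint G X) := mkStructure (extEdge O) (extSemi S₀)
  refine ⟨inferInstance, ⟨?_, ?_⟩, ⟨hasymm, ?_, ?_, ?_⟩, fun a b => Iff.rfl, extSemi_inl, ?_⟩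
  · intro g x y
    refine ⟨fun h => ?_, extEdge_smul hO g x y⟩
    have := extEdge_smul hO g⁻¹ (g • x) (g • y) h
    rwa [inv_smul_smul, inv_smul_smul] at this
  · intro g x
    refine ⟨fun h => ?_, extSemi_smul hSs g x⟩
    have := extSemi_smul hSs g⁻¹ (g • x) h
    rwa [inv_smul_smul] at this
  · intro x y z hxy hxz hyz
    by_cases h1 : adj x y
    · exact Or.inl h1
    by_cases h2 : adj x z
    · exact Or.inr (Or.inl h2)
    · exact Or.inr (Or.inr (hi3 x y z hxy hxz hyz h1 h2))
  · rintro x (⟨y, rfl, h⟩ | ⟨p, y, rfl, h⟩ | ⟨-, -, h⟩)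
    · exact Sum.inl_injective.comp (hX.injective y h)
    · exact p.emb_injective.comp (p.isLocallyD.injective y h)
    · exact hSi x h
  · intro x hx
    by_cases h1 : ∃ y : Fin 4 → X, x = Sum.inl ∘ y
    · obtain ⟨y, rfl⟩ := h1
      obtain ⟨π, hπ⟩ := hX.semifinal y hx.of_comp
      exact ⟨π, fun σ => by rw [← hπ σ]; exact extSemi_inl (y ∘ σ)⟩
    by_cases h2 : ∃ p y, x = NewPoint.emb p ∘ y
    · obtain ⟨p, y, rfl⟩ := h2
      obtain ⟨π, hπ⟩ := p.isLocallyD.semifinal y hx.of_comp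
      exact ⟨π, fun σ => by rw [← hπ σ]; exact extSemi_emb p (y ∘ σ)⟩
    · obtain ⟨π, hπ⟩ := hSf x hx
      refine ⟨π, fun σ => ?_⟩
      rw [← hπ σ]
      apply extSemi_of_not
      · rintro ⟨y, hy⟩
        refine h1 ⟨y ∘ (σ⁻¹ : Equiv.Perm (Fin 4)), ?_⟩
        rw [← Function.comp_assoc, ← hy]
        funext i; simp
      · rintro ⟨p, y, hy⟩
        refine h2 ⟨p, y ∘ (σ⁻¹ : Equiv.Perm (Fin 4)), ?_⟩
        rw [← Function.comp_assoc, ← hy]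
        funext i; simp
  · intro n b E S hb hES hE hS
    obtain ⟨m, c, hbc, hne, hg, hg'⟩ := hgood.exists_anchor hT b
    let p : NewPoint G X :=
      ⟨n, m, b, c, E, S, hb, hbc, hne, hES, hE, hS, fun i _ _ => hg i, hg'⟩
    exact ⟨p.emb, p.emb_injective, fun i => rfl, fun a => by simp [NewPoint.emb],
      extEdge_emb hO' p, extSemi_emb p⟩

end Extension

/-! ### Iterating the extension -/

/-- The extension property that characterizes the Fraïssé limit: every type over a finite set is
realized outside any given finite set. The type is given by a structure on `Option (Fin n)` whose
restriction to `Fin n` is induced by `b`. -/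
def IsRich (M : Type*) [lang.Structure M] : Prop :=
  ∀ (n : ℕ) (b : Fin n → M) (E : Option (Fin n) → Option (Fin n) → Prop)
    (S : (Fin 4 → Option (Fin n)) → Prop), Function.Injective b →
    @IsLocallyD (Option (Fin n)) (mkStructure E S) →
    (∀ i j, E (some i) (some j) ↔ edge (b i) (b j)) →
    (∀ x : Fin 4 → Fin n, S (some ∘ x) ↔ semi (b ∘ x)) →
    ∀ F : Set M, F.Finite →
      ∃ f : Option (Fin n) → M, Function.Injective f ∧ (∀ i, f (some i) = b i) ∧ f none ∉ F ∧
        (∀ i j, edge (f i) (f j) ↔ E i j) ∧ ∀ x, semi (f ∘ x) ↔ S x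

/-- A countable structure of the class with an action of `G` to which the one-step extension
applies. -/
structure Stage (G : Type) [Group G] where
  X : Type
  [mulAction : MulAction G X]
  [str : lang.Structure X]
  [actsByAut : ActsByAut G X]
  [countable : Countable X]
  [nonempty : Nonempty X]
  isLocallyD : IsLocallyD X
  hasGoodTuples : HasGoodTuples G X

namespace Stage

attribute [instance] mulAction str actsByAut countable nonempty

variable {G : Type} [Group G]

theorem exists_next (s : Stage G) : ∃ (t : Stage G) (f : s.X ↪[lang] t.X),
    (∀ (g : G) x, f (g • x) = g • f x) ∧
    ∀ (n : ℕ) (b : Fin n → s.X) (E : Option (Fin n) → Option (Fin n) → Prop)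
      (S : (Fin 4 → Option (Fin n)) → Prop), Function.Injective b →
      @IsLocallyD (Option (Fin n)) (mkStructure E S) →
      (∀ i j, E (some i) (some j) ↔ edge (b i) (b j)) →
      (∀ x : Fin 4 → Fin n, S (some ∘ x) ↔ semi (b ∘ x)) →
      ∃ h : Option (Fin n) → t.X, Function.Injective h ∧
        (∀ i, h (some i) = f (b i)) ∧ (∀ a, h none ≠ f a) ∧
        (∀ i j, edge (h i) (h j) ↔ E i j) ∧ ∀ x, semi (h ∘ x) ↔ S x := by
  obtain ⟨str, hact, hD, he, hs, hreal⟩ := exists_extension s.isLocallyD s.hasGoodTuples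
  exact ⟨⟨s.X ⊕ NewPoint G s.X, hD, hasGoodTuples_ext s.hasGoodTuples⟩,
    mkEmbedding Sum.inl Sum.inl_injective he hs, fun g x => rfl, hreal⟩

end Stage

/-- Every group action to which the one-step extension applies extends to an action on a countable
rich structure of the class. -/
theorem exists_rich_extension {G : Type} [Group G] (s : Stage G) :
    ∃ (M : Type) (_ : lang.Structure M) (f : s.X ↪[lang] M) (ρ : G →* (M ≃[lang] M)),
      Countable M ∧ IsLocallyD M ∧ IsRich M ∧ ∀ g x, ρ g (f x) = f (g • x) := by
  choose next emb hequi hreal using Stage.exists_next (G := G)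
  let t : ℕ → Stage G := fun n => @Nat.rec (fun _ => Stage G) s (fun _ => next) n
  let e : ∀ n, (t n).X ↪[lang] (t (n + 1)).X := fun n => emb (t n)
  let f : ∀ m n, m ≤ n → (t m).X ↪[lang] (t n).X := Language.DirectedSystem.natLERec e
  have hdir : DirectedSystem (fun n => (t n).X) fun i j h => f i j h :=
    Language.DirectedSystem.natLERec.directedSystem e
  let M := Language.DirectLimit (fun n => (t n).X) f
  let of : ∀ n, (t n).X ↪[lang] M := fun n => Language.DirectLimit.of lang ℕ (fun n => (t n).X) f n
  have hof : ∀ m n (h : m ≤ n) x, of n (f m n h x) = of m x := fun m n h x => Language.DirectLimit.of_f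
  have hex : ∀ z : M, ∃ n x, of n x = z := fun z => Language.DirectLimit.exists_of z
  have hset : ∀ F : Set M, F.Finite → ∃ n, ∀ z ∈ F, ∃ x, of n x = z := by
    intro F hF
    choose k x hx using hex
    obtain ⟨n, hn⟩ := (hF.image k).bddAbove
    exact ⟨n, fun z hz => ⟨f _ n (hn ⟨z, hz, rfl⟩) (x z), by rw [hof, hx]⟩⟩
  have htup : ∀ {m : ℕ} (z : Fin m → M), ∃ n, ∃ x : Fin m → (t n).X, z = of n ∘ x := by
    intro m z
    obtain ⟨n, hn⟩ := hset (Set.range z) (Set.finite_range z)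
    choose x hx using fun i => hn (z i) ⟨i, rfl⟩
    exact ⟨n, x, funext fun i => (hx i).symm⟩
  have hstep : ∀ n x, of (n + 1) (e n x) = of n x := by
    intro n x
    rw [← hof n (n + 1) (Nat.le_succ n)]
    congr 1
    have := congrFun (Language.DirectedSystem.coe_natLERec (L := lang) e n (n + 1) (Nat.le_succ n)) x
    rw [Nat.leRecOn_succ le_rfl, Nat.leRecOn_self] at this
    exact this.symm
  have hf : ∀ (g : G) m n (h : m ≤ n) x, f m n h (g • x) = g • f m n h x := by
    intro g m n h
    induction n, h using Nat.le_induction with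
    | base =>
      intro x
      have : ∀ x, f m m le_rfl x = x := fun x => Language.DirectedSystem.map_self f x
      rw [this, this]
    | succ n h ih =>
      intro x
      have : ∀ x, f m (n + 1) (Nat.le_succ_of_le h) x = e n (f m n h x) := by
        intro x
        apply (of (n + 1)).injective
        rw [hof, hstep, hof]
      rw [this, this, ih]
      exact hequi (t n) g _
  let a : G → ∀ n, (t n).X ≃[lang] (t n).X := fun g n =>
    mkEquiv (MulAction.toPerm g) (ActsByAut.edge_smul g) (ActsByAut.semi_smul g)
  let r : G → (M ≃[lang] M) := fun g =>
    Language.DirectLimit.equiv_lift lang ℕ (fun n => (t n).X) f (fun n => (t n).X) f (a g)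
      (fun m n h x => (hf g m n h x).symm)
  have hr : ∀ g n x, r g (of n x) = of n (g • x) := fun g n x =>
    Language.DirectLimit.equiv_lift_of lang ℕ (fun n => (t n).X) f (fun n => (t n).X) f (a g)
      (fun m n h x => (hf g m n h x).symm) x
  refine ⟨M, inferInstance, of 0, ⟨⟨r, ?_⟩, ?_⟩, ?_, ⟨?_, ?_, ?_, ?_⟩, ?_, fun g x => hr g 0 x⟩
  · ext z
    obtain ⟨n, x, rfl⟩ := hex z
    rw [hr, one_smul]
    rfl
  · intro g h
    ext z
    obtain ⟨n, x, rfl⟩ := hex z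
    change r (g * h) (of n x) = r g (r h (of n x))
    rw [hr, hr, hr, mul_smul]
  · have : Function.Surjective fun p : Σ n, (t n).X => of p.1 p.2 := by
      intro z
      obtain ⟨n, x, hx⟩ := hex z
      exact ⟨⟨n, x⟩, hx⟩
    exact this.countable
  · intro x y
    obtain ⟨n, z, hz⟩ := htup ![x, y]
    have hx : x = of n (z 0) := congrFun hz 0
    have hy : y = of n (z 1) := congrFun hz 1
    rw [hx, hy, edge_map, edge_map]
    exact (t n).isLocallyD.asymm _ _
  · intro x y w
    obtain ⟨n, z, hz⟩ := htup ![x, y, w]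
    have hx : x = of n (z 0) := congrFun hz 0
    have hy : y = of n (z 1) := congrFun hz 1
    have hw : w = of n (z 2) := congrFun hz 2
    rw [hx, hy, hw, adj_map, adj_map, adj_map]
    intro h1 h2 h3
    exact (t n).isLocallyD.i3_free _ _ _ (fun h => h1 (by rw [h])) (fun h => h2 (by rw [h]))
      (fun h => h3 (by rw [h]))
  · intro x hx
    obtain ⟨n, z, rfl⟩ := htup x
    exact (of n).injective.comp ((t n).isLocallyD.injective z ((semi_map (of n) z).1 hx))
  · intro x hx
    obtain ⟨n, z, rfl⟩ := htup x
    obtain ⟨π, hπ⟩ := (t n).isLocallyD.semifinal z hx.of_comp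
    exact ⟨π, fun σ => by rw [← hπ σ, ← semi_map (of n)]; rfl⟩
  · intro m b E S hb hD hE hS F hF
    obtain ⟨n, hn⟩ := hset (Set.range b ∪ F) ((Set.finite_range b).union hF)
    choose c hc using fun i => hn (b i) (Or.inl ⟨i, rfl⟩)
    obtain rfl : b = of n ∘ c := funext fun i => (hc i).symm
    obtain ⟨h, hi, hs, hnone, he, hS'⟩ := hreal (t n) m c E S hb.of_comp hD
      (fun i j => by rw [hE]; exact edge_map (of n) _ _)
      (fun x => by rw [hS]; exact semi_map (of n) (c ∘ x))
    refine ⟨of (n + 1) ∘ h, (of (n + 1)).injective.comp hi, ?_, ?_, ?_, ?_⟩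
    · intro i
      exact (congrArg (of (n + 1)) (hs i)).trans (hstep n (c i))
    · intro hmem
      obtain ⟨x, hx⟩ := hn _ (Or.inr hmem)
      refine hnone x ((of (n + 1)).injective ?_)
      exact hx.symm.trans (hstep n x).symm
    · intro i j
      rw [← he i j]
      exact edge_map (of (n + 1)) _ _
    · intro x
      rw [← hS' x]
      exact semi_map (of (n + 1)) (h ∘ x)

/-! ### Rich structures are Fraïssé limits -/

/-- Structures with fewer than four points carry the empty relation `S`. -/
theorem isLocallyD_of_card_lt {A : Type*} [Finite A] (hA : Nat.card A < 4) (E : A → A → Prop)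
    (hE : ∀ x y, E x y → ¬ E y x) (h3 : ∀ x y z : A, x ≠ y → x ≠ z → y ≠ z →
      (E x y ∨ E y x) ∨ (E x z ∨ E z x) ∨ (E y z ∨ E z y)) :
    @IsLocallyD A (mkStructure E fun _ => False) :=
  let _ := mkStructure E fun _ => False
  { asymm := hE
    i3_free := h3
    injective := fun _ h => h.elim
    semifinal := fun x hx => by
      have := Nat.card_le_card_of_injective x hx
      rw [Nat.card_fin] at this
      omega }

section Rich

variable {C : Type*} [lang.Structure C] {M : Type*} [lang.Structure M]

/-- The map `h` restricts to an embedding of the substructure on `s`. -/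
structure IsEmbOn (s : Set C) (h : C → M) : Prop where
  injOn : Set.InjOn h s
  edge_iff : ∀ x ∈ s, ∀ y ∈ s, edge (h x) (h y) ↔ edge x y
  semi_iff : ∀ x : Fin 4 → C, (∀ i, x i ∈ s) → (semi (h ∘ x) ↔ semi x)

theorem IsRich.exists_insert (hM : IsRich M) (hC : IsLocallyD C) {s : Finset C} {h : C → M}
    (hs : IsEmbOn (s : Set C) h) {c : C} (hc : c ∉ s) {F : Set M} (hF : F.Finite) :
    ∃ h' : C → M, IsEmbOn (insert c (s : Set C)) h' ∧ Set.EqOn h' h s ∧ h' c ∉ F := by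
  classical
  let e : Fin s.card ≃ s := s.equivFin.symm
  let j : Option (Fin s.card) → C := fun o => o.elim c fun i => (e i : C)
  have hmem : ∀ i, (e i : C) ∈ s := fun i => (e i).2
  have hj : Function.Injective j := by
    rintro (_ | a) (_ | b) hab
    · rfl
    · exact absurd ((show c = e b from hab) ▸ hmem b) hc
    · exact absurd ((show (e a : C) = c from hab) ▸ hmem a) hc
    · rw [e.injective (Subtype.ext hab)]
  have hjs : ∀ x ∈ insert c (s : Set C), ∃ i, j i = x := by
    rintro x (rfl | hx)
    · exact ⟨none, rfl⟩
    · exact ⟨some (e.symm ⟨x, hx⟩), by simp [j]⟩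
  let E : Option (Fin s.card) → Option (Fin s.card) → Prop := fun i k => edge (j i) (j k)
  let S : (Fin 4 → Option (Fin s.card)) → Prop := fun x => semi (j ∘ x)
  have hES : @IsLocallyD _ (mkStructure E S) := by
    let _ := mkStructure E S
    exact hC.of_embedding (mkEmbedding j hj (fun _ _ => Iff.rfl) fun _ => Iff.rfl)
  obtain ⟨f, hf, hfb, hfF, hfE, hfS⟩ := hM s.card (fun i => h (e i)) E S
    (fun a b hab => e.injective (Subtype.ext (hs.injOn (hmem a) (hmem b) hab))) hES
    (fun a b => (hs.edge_iff _ (hmem a) _ (hmem b)).symm)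
    (fun x => (hs.semi_iff (fun i => (e (x i) : C)) fun i => hmem (x i)).symm) F hF
  have hcomp : ∀ i, Function.update h c (f none) (j i) = f i := by
    rintro (_ | i)
    · simp [j]
    · have : (e i : C) ≠ c := fun h => hc (h ▸ hmem i)
      simp [j, hfb, this]
  refine ⟨Function.update h c (f none), ⟨?_, ?_, ?_⟩, ?_, by simpa using hfF⟩
  · intro x hx y hy hxy
    obtain ⟨i, rfl⟩ := hjs x hx
    obtain ⟨k, rfl⟩ := hjs y hy
    rw [hcomp, hcomp] at hxy
    rw [hf hxy]
  · intro x hx y hy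
    obtain ⟨i, rfl⟩ := hjs x hx
    obtain ⟨k, rfl⟩ := hjs y hy
    rw [hcomp, hcomp]
    exact hfE i k
  · intro x hx
    choose y hy using fun i => hjs (x i) (hx i)
    obtain rfl : j ∘ y = x := funext hy
    have : Function.update h c (f none) ∘ (j ∘ y) = f ∘ y := funext fun i => hcomp (y i)
    rw [this]
    exact hfS y
  · intro x hx
    have : x ≠ c := fun h => hc (h ▸ hx)
    simp [this]

theorem IsRich.exists_union (hM : IsRich M) (hC : IsLocallyD C) {s : Finset C} {h : C → M}
    (hs : IsEmbOn (s : Set C) h) {F : Set M} (hF : F.Finite) (t : Finset C) :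
    ∃ h' : C → M, IsEmbOn (s ∪ t : Set C) h' ∧ Set.EqOn h' h s ∧ ∀ c ∈ t, c ∉ s → h' c ∉ F := by
  classical
  induction t using Finset.induction_on with
  | empty => exact ⟨h, by simpa using hs, fun _ _ => rfl, by simp⟩
  | insert c t hct ih =>
    obtain ⟨h', h1, h2, h3⟩ := ih
    by_cases hcs : c ∈ s
    · refine ⟨h', ?_, h2, ?_⟩
      · have : (s : Set C) ∪ ((insert c t : Finset C) : Set C) = (s : Set C) ∪ (t : Set C) := by
          ext x
          simp only [Finset.coe_insert, Set.mem_union, Set.mem_insert_iff]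
          constructor
          · rintro (h | rfl | h)
            exacts [Or.inl h, Or.inl hcs, Or.inr h]
          · rintro (h | h)
            exacts [Or.inl h, Or.inr (Or.inr h)]
        rwa [this]
      · intro d hd hds
        rcases Finset.mem_insert.1 hd with rfl | hd
        · exact absurd hcs hds
        · exact h3 d hd hds
    · rw [← Finset.coe_union] at h1
      have hcu : c ∉ s ∪ t := by simp [hcs, hct]
      obtain ⟨h'', k1, k2, k3⟩ := hM.exists_insert hC h1 hcu hF
      refine ⟨h'', ?_, ?_, ?_⟩
      · simpa [Set.insert_union] using k1
      · exact fun x hx => (k2 (by simp [Finset.mem_coe.1 hx])).trans (h2 hx)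
      · intro d hd hds
        rcases Finset.mem_insert.1 hd with rfl | hd
        · exact k3
        · rw [k2 (by simp [hd])]
          exact h3 d hd hds

theorem IsRich.infinite (hM : IsRich M) : Infinite M := by
  by_contra hfin
  rw [not_infinite_iff_finite] at hfin
  obtain ⟨f, -, -, hf, -⟩ := hM 0 Fin.elim0 (fun _ _ => False) (fun _ => False)
    (fun i => i.elim0)
    (isLocallyD_of_card_lt (by simp) _ (by simp)
      fun x y z hxy => absurd (Subsingleton.elim x y) hxy)
    (fun i => i.elim0) (fun x => (x 0).elim0) Set.univ Set.finite_univ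
  exact hf trivial

/-- An embedding into a rich structure extends to finite structures of the class, with the new
points outside a given finite set. -/
theorem IsRich.exists_embedding (hM : IsRich M) (hC : IsLocallyD C) [Finite C] {A : Type*}
    [lang.Structure A] (i : A ↪[lang] C) (f : A ↪[lang] M) {F : Set M} (hF : F.Finite) :
    ∃ k : C ↪[lang] M, (∀ a, k (i a) = f a) ∧ ∀ c, c ∉ Set.range i → k c ∉ F := by
  classical
  have := Fintype.ofFinite C
  have : Infinite M := hM.infinite
  obtain ⟨m⟩ : Nonempty M := inferInstance
  let h : C → M := Function.extend i f fun _ => m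
  have hh : ∀ a, h (i a) = f a := fun a => i.injective.extend_apply f _ a
  have hs : IsEmbOn ((Set.range i).toFinset : Set C) h := by
    rw [Set.coe_toFinset]
    refine ⟨?_, ?_, ?_⟩
    · rintro _ ⟨a, rfl⟩ _ ⟨b, rfl⟩ hab
      rw [hh, hh] at hab
      rw [f.injective hab]
    · rintro _ ⟨a, rfl⟩ _ ⟨b, rfl⟩
      rw [hh, hh, edge_map, edge_map]
    · intro x hx
      choose y hy using hx
      obtain rfl : i ∘ y = x := funext hy
      have : h ∘ (i ∘ y) = f ∘ y := funext fun j => hh (y j)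
      rw [this, semi_map, semi_map]
  obtain ⟨k, h1, h2, h3⟩ := hM.exists_union hC hs hF Finset.univ
  rw [Finset.coe_univ, Set.union_univ] at h1
  refine ⟨mkEmbedding k (Set.injOn_univ.1 h1.injOn) (fun x y => h1.edge_iff x trivial y trivial)
    (fun x => h1.semi_iff x fun _ => trivial), fun a => ?_, fun c hc => ?_⟩
  · rw [mkEmbedding_apply, h2 (by simp), hh]
  · exact h3 c (Finset.mem_univ c) (by simpa using hc)

end Rich

section FraisseLimit

open Language

variable {M : Type} [lang.Structure M]

theorem IsRich.age_eq (hM : IsRich M) (hD : IsLocallyD M) : lang.age M = classD := by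
  ext A
  rw [mem_classD_iff]
  constructor
  · rintro ⟨hfg, ⟨f⟩⟩
    exact ⟨Structure.fg_iff_finite.1 hfg, hD.of_embedding f⟩
  · rintro ⟨hfin, hA⟩
    refine ⟨Structure.fg_iff_finite.2 hfin, ?_⟩
    let _ : lang.Structure Empty := mkStructure (fun _ _ => False) fun _ => False
    obtain ⟨k, -⟩ := hM.exists_embedding hA (A := Empty)
      (mkEmbedding Empty.elim (fun x => x.elim) (fun x => x.elim) fun x => (x 0).elim)
      (mkEmbedding Empty.elim (fun x => x.elim) (fun x => x.elim) fun x => (x 0).elim)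
      Set.finite_empty
    exact ⟨k⟩

theorem IsRich.isUltrahomogeneous [Countable M] (hM : IsRich M) (hD : IsLocallyD M) :
    lang.IsUltrahomogeneous M := by
  rw [isUltrahomogeneous_iff_IsExtensionPair Structure.cg_of_countable,
    isExtensionPair_iff_exists_embedding_closure_singleton_sup]
  intro S hS f m
  have hfg : (Substructure.closure lang {m} ⊔ S).FG :=
    (Substructure.fg_closure_singleton m).sup hS
  have hfin : Finite ↥(Substructure.closure lang {m} ⊔ S) :=
    Structure.fg_iff_finite.1 ((Substructure.fg_iff_structure_fg _).1 hfg)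
  obtain ⟨k, hk, -⟩ := hM.exists_embedding (hD.of_embedding (Substructure.subtype _))
    (Substructure.inclusion
      (le_sup_right : S ≤ Substructure.closure lang {m} ⊔ S)) f Set.finite_empty
  exact ⟨k, Embedding.ext fun x => (hk x).symm⟩

theorem IsRich.isFraisseLimit [Countable M] (hM : IsRich M) (hD : IsLocallyD M) :
    IsFraisseLimit classD M :=
  ⟨hM.isUltrahomogeneous hD, hM.age_eq hD⟩

theorem IsRich.isTransitive [Countable M] (hM : IsRich M) (hD : IsLocallyD M) :
    IsTransitive lang M := by
  intro x y
  have hsub : ∀ z : Substructure.closure lang {x}, (z : M) = x := fun z => by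
    have := z.2
    rwa [Substructure.mem_closure_iff_of_isRelational] at this
  have hsub' : Subsingleton (Substructure.closure lang {x}) :=
    ⟨fun a b => Subtype.ext ((hsub a).trans (hsub b).symm)⟩
  have hD' : IsLocallyD (Substructure.closure lang {x}) :=
    hD.of_embedding (Substructure.subtype _)
  have hns : ∀ (N : Type) [lang.Structure N] (_ : IsLocallyD N) (z : N) (t : Fin 4 → N),
      (∀ i, t i = z) → ¬ semi t := fun N _ hN z t ht hs =>
    absurd (hN.injective t hs ((ht 0).trans (ht 1).symm)) (by decide)
  obtain ⟨g, hg⟩ := hM.isUltrahomogeneous hD (Substructure.closure lang {x})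
    (Substructure.fg_closure_singleton x)
    (mkEmbedding (fun _ => y) (fun a b _ => Subsingleton.elim a b)
      (fun a b => by
        rw [Subsingleton.elim b a]
        exact iff_of_false (hD.irrefl y) (hD'.irrefl a))
      (fun t => iff_of_false (hns M hD y _ fun _ => rfl)
        (hns _ hD' (t 0) t fun _ => Subsingleton.elim _ _)))
  refine ⟨g, ?_⟩
  have := DFunLike.congr_fun hg ⟨x, Substructure.subset_closure rfl⟩
  exact this.symm

/-- Over an embedding of `B` in `M`, the other factor `C` embeds in `M` with `C \ A` outside the
image of `B`. -/
theorem IsRich.hasStrongAmalgamation (hM : IsRich M) (hD : IsLocallyD M) :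
    HasStrongAmalgamation lang M := by
  intro A B C _ hB hC f g
  obtain ⟨hBfg, ⟨e⟩⟩ := hB
  obtain ⟨hCfg, ⟨e'⟩⟩ := hC
  have : Finite B := Structure.fg_iff_finite.1 hBfg
  have : Finite C := Structure.fg_iff_finite.1 hCfg
  obtain ⟨k, hk, hk'⟩ := hM.exists_embedding (hD.of_embedding e') g (e.comp f)
    (Set.finite_range e)
  refine ⟨CategoryTheory.Bundled.of ↥(e.toHom.range ⊔ k.toHom.range),
    age.fg_substructure ((hBfg.range _).sup (hCfg.range _)),
    (Substructure.inclusion le_sup_left).comp e.equivRange.toEmbedding,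
    (Substructure.inclusion le_sup_right).comp k.equivRange.toEmbedding, ?_, ?_⟩
  · ext a
    exact Subtype.ext (hk a).symm
  · ext z
    constructor
    · rintro ⟨⟨b, rfl⟩, c, hc⟩
      have hc' : k c = e b := congrArg Subtype.val hc
      by_cases hcg : c ∈ Set.range g
      · obtain ⟨a, rfl⟩ := hcg
        refine ⟨a, Subtype.ext ?_⟩
        exact (hk a).symm.trans hc'
      · exact absurd ⟨b, hc'.symm⟩ (hk' c hcg)
    · rintro ⟨a, rfl⟩
      exact ⟨⟨f a, rfl⟩, g a, Subtype.ext (hk a)⟩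

end FraisseLimit

/-! ### Universality of the automorphism group -/

section Universal

open Language

/-- Automorphisms act by application. -/
instance autMulAction (A : Type*) [lang.Structure A] : MulAction (A ≃[lang] A) A where
  smul f x := f x
  one_smul _ := rfl
  mul_smul _ _ _ := rfl

theorem aut_smul_def {A : Type*} [lang.Structure A] (f : A ≃[lang] A) (x : A) : f • x = f x := rfl

instance actsByAut_aut (A : Type*) [lang.Structure A] : ActsByAut (A ≃[lang] A) A where
  edge_smul f := edge_map f.toEmbedding
  semi_smul f := semi_map f.toEmbedding

/-- Conjugation by an isomorphism, as a homomorphism of automorphism groups. -/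
def autConj {M N : Type*} [lang.Structure M] [lang.Structure N] (e : M ≃[lang] N) :
    (M ≃[lang] M) →* (N ≃[lang] N) where
  toFun f := e.comp (f.comp e.symm)
  map_one' := by
    ext x
    exact e.apply_symm_apply x
  map_mul' f g := by
    ext x
    change e (f (g (e.symm x))) = e (f (e.symm (e (g (e.symm x)))))
    rw [e.symm_apply_apply]

theorem autConj_apply {M N : Type*} [lang.Structure M] [lang.Structure N] (e : M ≃[lang] N)
    (f : M ≃[lang] M) (x : M) : autConj e f (e x) = e (f x) := by
  change e (f (e.symm (e x))) = e (f x)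
  rw [e.symm_apply_apply]

/-- A group with a faithful action on a stage of the construction embeds in the automorphism group
of the Fraïssé limit, as the limit of the construction is isomorphic to it. -/
theorem Stage.exists_injective_hom {G : Type} [Group G] (s : Stage G)
    (hs : ∀ g h : G, (∀ x : s.X, g • x = h • x) → g = h) {M : Type} [lang.Structure M]
    [Countable M] (hM : IsRich M) (hD : IsLocallyD M) :
    ∃ φ : G →* (M ≃[lang] M), Function.Injective φ := by
  obtain ⟨N, _, f, ρ, hcount, hND, hN, hρ⟩ := exists_rich_extension s
  obtain ⟨e⟩ := (hN.isFraisseLimit hND).nonempty_equiv (hM.isFraisseLimit hD)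
  refine ⟨(autConj e).comp ρ, fun g h hgh => hs g h fun x => ?_⟩
  apply f.injective
  apply e.injective
  rw [← hρ, ← hρ, ← autConj_apply, ← autConj_apply]
  exact DFunLike.congr_fun hgh (e (f x))

/-- A point without good tuples is adjacent to all others and fixed by all automorphisms, so that
its complement carries a faithful action of the automorphism group, for which all tuples are
good. -/
theorem exists_stage_of_not_hasGoodTuples {A : Type} [lang.Structure A] [Countable A]
    [Nontrivial A] (hA : IsLocallyD A) (h : ¬ HasGoodTuples (A ≃[lang] A) A) :
    ∃ s : Stage (A ≃[lang] A), ∀ g h : A ≃[lang] A, (∀ x : s.X, g • x = h • x) → g = h := by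
  have hT := tameAction (G := A ≃[lang] A) hA
  obtain ⟨c, hc⟩ : ∃ c : A, ∀ (m : ℕ) (t : Fin m → A), (∃ i j, t i ≠ t j) →
      ¬ IsGood (A ≃[lang] A) t c := by
    simpa only [HasGoodTuples, not_forall, not_exists, not_and] using h
  have key : ∀ d, d ≠ c → ∃ g : A ≃[lang] A, g • c = c ∧ g • g • d = d ∧ g • d ≠ d := by
    intro d hd
    have := hc 2 ![c, d] ⟨0, 1, hd.symm⟩
    simp only [IsGood, not_forall] at this
    obtain ⟨g, h1, h2, h3⟩ := this
    refine ⟨g, h1, congrFun h2 1, fun h4 => h3 ?_⟩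
    funext i
    fin_cases i
    · exact h1
    · exact h4
  have hadj : ∀ d, d ≠ c → adj c d := by
    intro d hd
    obtain ⟨g, h1, h2, h3⟩ := key d hd
    have hgd : g • d ≠ c := fun h => hd ((MulAction.injective g) (h.trans h1.symm))
    rcases hA.i3_free c d (g • d) hd.symm hgd.symm h3.symm with h | h | h
    · exact h
    · rw [← adj_smul (G := A ≃[lang] A) g, h1, h2] at h
      exact h
    · exact absurd h (not_adj_of_swap hA rfl h2)
  have hfix : ∀ k : A ≃[lang] A, k • c = c := by
    intro k
    by_contra hk
    obtain ⟨g, h1, h2, h3⟩ := key _ hk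
    refine not_adj_of_swap hA rfl h2 ?_
    rw [← adj_smul (G := A ≃[lang] A) k⁻¹, inv_smul_smul]
    exact hadj _ fun h => h3 (inv_smul_eq_iff.1 h)
  let X : SubMulAction (A ≃[lang] A) A :=
    { carrier := {x | x ≠ c}
      smul_mem' := fun k x hx h => hx ((MulAction.injective k) (h.trans (hfix k).symm)) }
  let _ : lang.Structure X :=
    mkStructure (fun x y => edge (x : A) y) fun x => semi fun i => (x i : A)
  have hact : ActsByAut (A ≃[lang] A) X :=
    ⟨fun g x y => ActsByAut.edge_smul g (x : A) y,
      fun g x => ActsByAut.semi_smul g fun i => (x i : A)⟩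
  have hXD : IsLocallyD X := hA.of_embedding
    (mkEmbedding (fun x : X => (x : A)) Subtype.val_injective (fun _ _ => Iff.rfl)
      fun _ => Iff.rfl)
  obtain ⟨d, hd⟩ := exists_ne c
  obtain ⟨g, h1, h2, h3⟩ := key d hd
  have hgd : g • d ≠ c := fun h => hd ((MulAction.injective g) (h.trans h1.symm))
  have hgood : HasGoodTuples (A ≃[lang] A) X := by
    intro x
    refine ⟨2, ![⟨d, hd⟩, ⟨g • d, hgd⟩], ⟨0, 1, fun h => h3 (congrArg Subtype.val h).symm⟩, ?_⟩
    intro k hk hkk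
    funext i
    apply Subtype.ext
    exact hT.no_two k _ x c (congrArg Subtype.val (congrFun hkk i)) (congrArg Subtype.val hk)
      (hfix k) x.2
  have : Nonempty X := ⟨⟨d, hd⟩⟩
  refine ⟨⟨X, hXD, hgood⟩, fun g h hgh => ?_⟩
  ext x
  by_cases hx : x = c
  · rw [hx]
    exact (hfix g).trans (hfix h).symm
  · exact congrArg Subtype.val (hgh ⟨x, hx⟩)

theorem IsRich.hasUniversalAut {M : Type} [lang.Structure M] [Countable M] (hM : IsRich M)
    (hD : IsLocallyD M) : HasUniversalAut lang M := by
  rintro A ⟨e⟩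
  have hA : IsLocallyD A := hD.of_embedding e
  have : Countable A := e.injective.countable
  rcases subsingleton_or_nontrivial A with hs | hn
  · refine ⟨1, fun f g _ => ?_⟩
    ext x
    exact Subsingleton.elim _ _
  · by_cases hgood : HasGoodTuples (A ≃[lang] A) A
    · exact Stage.exists_injective_hom ⟨A, hA, hgood⟩
        (fun g h hgh => by ext x; exact hgh x) hM hD
    · obtain ⟨s, hs⟩ := exists_stage_of_not_hasGoodTuples hA hgood
      exact s.exists_injective_hom hs hM hD

end Universal

/-! ### Failure of group-extensibility -/

section Extensible

open Language

/-- The three-point structure with edges `0 → 1` and `0 → 2`. -/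
@[reducible]
def cherry : lang.Structure (Fin 3) := mkStructure (fun x y => x = 0 ∧ y ≠ 0) fun _ => False

/-- The involution of the three-point structure cannot extend to an involution of `M`: the latter
moves each `y` not adjacent to the fixed point `c`, so that `c`, `y` and its image are pairwise not
adjacent. -/
theorem IsRich.not_isGroupExtensible {M : Type} [lang.Structure M] (hM : IsRich M)
    (hD : IsLocallyD M) : ¬ IsGroupExtensible lang M := by
  intro hext
  let _ := cherry
  have hcherry : IsLocallyD (Fin 3) := isLocallyD_of_card_lt (by simp) _
    (by decide) (by decide)
  have hmem : (⟨Fin 3, cherry⟩ : CategoryTheory.Bundled lang.Structure) ∈ lang.age M := by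
    rw [hM.age_eq hD, mem_classD_iff]
    exact ⟨inferInstanceAs (Finite (Fin 3)), hcherry⟩
  obtain ⟨f, η, -, hη⟩ := hext _ hmem.2
  change Fin 3 ↪[lang] M at f
  have hrel : ∀ x y : Fin 3, edge (Equiv.swap 1 2 x : Fin 3) (Equiv.swap 1 2 y) ↔ edge x y := by
    change ∀ x y : Fin 3, (_ = _ ∧ _ ≠ _) ↔ (_ = _ ∧ _ ≠ _)
    decide
  let τ : Fin 3 ≃[lang] Fin 3 := mkEquiv (Equiv.swap 1 2) hrel fun _ => Iff.rfl
  let g := autConj f.equivRange τ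
  have hk : ∀ i, η g (f i) = f (Equiv.swap 1 2 i) := by
    intro i
    refine (hη g (f.equivRange i)).trans ?_
    exact congrArg Subtype.val (autConj_apply f.equivRange τ i)
  have hgg : g * g = 1 := by
    rw [← map_mul]
    have : τ * τ = 1 := by
      ext x
      exact congrArg _ (Equiv.swap_apply_self 1 2 x)
    rw [this, map_one]
  have hkk : ∀ y, η g (η g y) = y := by
    intro y
    have : η g * η g = 1 := by rw [← map_mul, hgg, map_one]
    exact DFunLike.congr_fun this y
  -- a point not adjacent to the fixed point
  obtain ⟨h, hi, hs, -, he, -⟩ := hM 1 ![f 0] (fun _ _ => False) (fun _ => False)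
    (fun a b _ => Subsingleton.elim a b)
    (isLocallyD_of_card_lt (by simp) _ (by simp) fun x y z h1 h2 h3 => by
      exfalso; revert x y z; decide)
    (fun i j => by
      rw [Subsingleton.elim i 0, Subsingleton.elim j 0]
      exact iff_of_false id (hD.irrefl _))
    (fun x => iff_of_false id fun hx =>
      absurd (hD.injective _ hx (congrArg ![f 0] (Subsingleton.elim (x 0) (x 1)))) (by decide))
    ∅ Set.finite_empty
  have hfy : f 0 ≠ h none := by
    rw [show f 0 = h (some 0) from (hs 0).symm]
    exact hi.ne (by simp)
  have hna : ¬ adj (f 0) (h none) := by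
    rw [show f 0 = h (some 0) from (hs 0).symm]
    simp only [adj, he, or_self, not_false_iff]
  generalize h none = y at *
  have hk0 : η g (f 0) = f 0 := hk 0
  have hmove : η g y ≠ y := by
    intro hy
    have := (tameAction (G := M ≃[lang] M) hD).no_two (η g) (f 1) (f 0) y (hkk _) hk0 hy hfy
    exact absurd (f.injective ((hk 1).symm.trans this)) (by decide)
  have hna' : ¬ adj (f 0) (η g y) := by
    rw [← adj_smul (G := M ≃[lang] M) (η g)] at hna
    rwa [aut_smul_def, hk0] at hna
  have hne : f 0 ≠ η g y := fun h => hfy ((η g).injective (hk0.trans h))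
  rcases hD.i3_free (f 0) y (η g y) hfy hne hmove.symm with h | h | h
  · exact hna h
  · exact hna' h
  · exact not_adj_of_swap (G := M ≃[lang] M) hD rfl (hkk y) h

end Extensible

/-! ### The Fraïssé limit -/

theorem exists_countable_rich :
    ∃ (D : Type) (_ : lang.Structure D), Countable D ∧ IsLocallyD D ∧ IsRich D := by
  let _ : lang.Structure Bool := mkStructure (fun x y => x = true ∧ y = false) fun _ => False
  have hB : IsLocallyD Bool := isLocallyD_of_card_lt (by simp) _ (by decide) (by decide)
  let _ : MulAction Unit Bool :=
    { smul := fun _ x => x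
      one_smul := fun _ => rfl
      mul_smul := fun _ _ _ => rfl }
  have : ActsByAut Unit Bool := ⟨fun _ _ _ => Iff.rfl, fun _ _ => Iff.rfl⟩
  obtain ⟨D, _, -, -, hc, hD, hR, -⟩ := exists_rich_extension (G := Unit)
    ⟨Bool, hB, fun x => ⟨2, ![true, false], ⟨0, 1, by simp⟩, fun _ _ _ => rfl⟩⟩
  exact ⟨D, _, hc, hD, hR⟩

theorem finite_symbols : Finite lang.Symbols := by
  have : Finite (Σ l, Rel l) := by
    refine Finite.of_surjective (fun b : Bool => if b then ⟨2, Rel.R⟩ else ⟨4, Rel.S⟩) ?_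
    rintro ⟨_, _ | _⟩
    · exact ⟨true, rfl⟩
    · exact ⟨false, rfl⟩
  have h1 : Finite (Σ l, lang.Relations l) := this
  have h2 : Finite (Σ l, lang.Functions l) :=
    have : IsEmpty (Σ l, lang.Functions l) := ⟨fun p => Empty.elim p.2⟩
    inferInstance
  exact inferInstanceAs (Finite (_ ⊕ _))

end SemifinalStructure

/-- The Fraïssé limit `D` of the class of finite `I₃`-free oriented graphs with a semifinal relation
exists, and is a transitive Fraïssé structure in a finite relational language with strong
amalgamation, whose automorphism group is universal and whose `ω`-age is not group-extensible.
In particular, universality of the automorphism group of a Fraïssé structure does not imply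
group-extensibility of its `ω`-age. -/
theorem theorem1 :
    (SemifinalStructure.lang.IsRelational ∧ Finite SemifinalStructure.lang.Symbols ∧
      ∃ (D : Type) (_ : SemifinalStructure.lang.Structure D) (_ : Countable D),
        FirstOrder.Language.IsFraisseLimit SemifinalStructure.classD D ∧
        SemifinalStructure.IsFraisseStructure SemifinalStructure.lang D ∧
        SemifinalStructure.IsTransitive SemifinalStructure.lang D ∧
        SemifinalStructure.HasStrongAmalgamation SemifinalStructure.lang D ∧
        SemifinalStructure.HasUniversalAut SemifinalStructure.lang D ∧
        ¬ SemifinalStructure.IsGroupExtensible SemifinalStructure.lang D) ∧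
    ¬ (∀ (L : FirstOrder.Language.{0, 0}) (M : Type) [L.Structure M],
        SemifinalStructure.IsFraisseStructure L M →
        SemifinalStructure.HasUniversalAut L M →
        SemifinalStructure.IsGroupExtensible L M) := by
  obtain ⟨D, _, hc, hD, hR⟩ := SemifinalStructure.exists_countable_rich
  have hF : SemifinalStructure.IsFraisseStructure SemifinalStructure.lang D := ⟨hc, hR.infinite, hR.isUltrahomogeneous hD⟩
  exact ⟨⟨inferInstance, SemifinalStructure.finite_symbols, D, _, hc, hR.isFraisseLimit hD, hF,
    hR.isTransitive hD, hR.hasStrongAmalgamation hD, hR.hasUniversalAut hD,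
    hR.not_isGroupExtensible hD⟩,
    fun h => hR.not_isGroupExtensible hD (h SemifinalStructure.lang D hF (hR.hasUniversalAut hD))⟩
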